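/- Let $F_n$ be the free group of rank $n$ and let $G$ be a finite subgroup of $\mathrm{Aut}(F_n)$. A pointed marked $G$-graph $\rho=[s,\Gamma]$ is a finite connected pointed graph $(\Gamma,*)$ with no vertex of valence one and with all vertices other than $*$ of valence at least three, together with an isomorphism $s: F_n\to\pi_1(\Gamma,*)$ and an action of $G$ on $(\Gamma,*)$ by graph automorphisms (possibly inverting edges) that induces, via $s$, the given action of $G$ on $F_n$. It is reduced if $\Gamma$ has no $G$-invariant forest containing an edge. Oriented edges are used throughout, $\bar a$ is $a$ reversed, $E(\Gamma)$ is the set of oriented edges, and $E_v$ is the set of oriented edges ending at the vertex $v$. Absolute values. List the conjugacy classes of $F_n$ as $w_1,w_2,\dots$ and the elements of $F_n$ as $\alpha_1,\alpha_2,\dots$. For an oriented edge $e$, let $(|e|_{out})_i$ be the sum over $x\in G$ of the number of occurrences of $e$ or $\bar e$ in the cyclically reduced loop of $\Gamma$ representing $xw_i$; for $A,B\subseteq E(\Gamma)$ let $((A.B)_{out})_i$ be the sum over $x\in G$ of the number of occurrences of $a\bar b$ or $b\bar a$ ($a\in A$, $b\in B$) in that loop. Let $|e|_{aut}$ and $(A.B)_{aut}$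 be defined in the same way with the reduced (not cyclically reduced) paths at $*$ representing $x\alpha_i$. For $A\subseteq E(\Gamma)$ define $|A|_{out}$ and $|A|_{aut}$ by $|\{e\}|=|e|$ and $|A\sqcup B|=|A|+|B|-2(A.B)$. Put $|\cdot|_{tot}=(|\cdot|_{out},|\cdot|_{aut})$, with values in a product of two lexicographically ordered groups of integer sequences, itself ordered lexicographically. The norm $\|\rho\|_{out}$ has $i$-th coordinate the sum over $x\in G$ of the lengths of the cyclically reduced loops representing $xw_i$. Ideal edges. For $\alpha\subseteq E_v$ let $G\alpha$ also denote the union of the translates of $\alpha$, and let $D(\alpha)=\{a\in\alpha:\ \mathrm{stab}(a)=\mathrm{stab}(\alpha),\ \bar a\notin G\alpha\}$. The set $\alpha$ is an ideal edge at $v$ if $|\alpha|\ge 2$ and $|E_v-\alpha|\ge 2$ (only $|E_v-\alpha|\ge1$ if $v=*$), each translate $x\alpha$, $x\in G$, is equal to $\alpha$ or disjoint from it, and $D(\alpha)\neq\emptyset$. It is invertible if $E_v-\alpha\not\subseteq G\alpha$ and $E_v-\alpha$ is an ideal edge. For $a\in D(\alpha)$ put $red_{x}(\alpha,a)=[G:\mathrm{stab}(\alpha)](|a|_{x}-|\alpha|_{x})$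 ($x=out,aut,tot$); $\alpha$ is tot-reductive if $\max_{a\in D(\alpha)}red_{tot}(\alpha,a)>0$. For $a\in D(\alpha)$, the Whitehead move $(G\alpha,Ga)$ blows up the translates of $\alpha$ (each $x\alpha$ is pulled off its vertex $xv$ to a new vertex, joined to $xv$ by a new edge; if $v=*$ the basepoint stays at the old vertex) and then collapses the orbit of $a$. Proposition. Let $\rho$ be a reduced pointed marked $G$-graph and let $\alpha\subseteq E_v$ be a tot-reductive ideal edge of $\rho$ which is invertible. Then $\alpha^{-1}=E_v-\alpha$ is tot-reductive. Moreover, if $v=*$, then for every $a\in D(\alpha)$ with $red_{tot}(\alpha,a)>0$ the result $\rho'$ of the Whitehead move $(G\alpha,Ga)$ satisfies $\|\rho'\|_{out}\neq\|\rho\|_{out}$. -/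

import Mathlib

open scoped Pointwise

noncomputable section

namespace AuterSpace

/-- Oriented edges of a graph whose set of unoriented edges is `E`; each `e : E` carries the two
orientations `(e, true)` and `(e, false)`. Words in oriented edges are the words over which
Mathlib's `FreeGroup E` is built. -/
abbrev Dart (E : Type*) := E × Bool

/-- The oriented edge `ē`, i.e. `e` traversed backwards. -/
def Dart.rev {E : Type*} (d : Dart E) : Dart E := (d.1, !d.2)

/-- The data of a pointed graph with vertices `V` and edges `E`, together with a marking.
The marking is recorded by its effect on `π₁`: a reduced edge path is a reduced word in `FreeGroup E`
(`(e, true)` is the generator `e`, `(e, false)` its inverse), concatenation followed by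
cancellation of backtracks being the multiplication of `FreeGroup E`; so `π₁(Γ, *)` is the subgroup
of `FreeGroup E` of the elements whose reduced word is a closed path at `*`, and
the marking is a map from the free group of rank `n` to `FreeGroup E` with values in it. -/
structure MarkedGraph (n : ℕ) (V E : Type*) where
  /-- terminal vertex of an oriented edge -/
  term : Dart E → V
  /-- the basepoint `*` -/
  base : V
  /-- the marking -/
  mark : FreeGroup (Fin n) →* FreeGroup E

namespace MarkedGraph

variable {n : ℕ} {V E : Type*}

/-- Initial vertex of an oriented edge. -/
def init (Γ : MarkedGraph n V E) (d : Dart E) : V := Γ.term d.rev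

/-- `Γ.IsPath u p v`: the list `p` of oriented edges is an edge path from `u` to `v`. -/
def IsPath (Γ : MarkedGraph n V E) : V → List (Dart E) → V → Prop
  | u, [], v => u = v
  | u, d :: p, v => Γ.init d = u ∧ Γ.IsPath (Γ.term d) p v

/-- `E_v`, the set of oriented edges ending at `v`. -/
def star (Γ : MarkedGraph n V E) (v : V) : Set (Dart E) := {d | Γ.term d = v}

open Classical in
/-- `Γ` is an admissible pointed graph (connected, no free edges, all vertices other than the
basepoint of valence at least three), and the marking is an isomorphism from the free group of
rank `n` onto `π₁(Γ, *)`. -/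
structure IsMarkedGraph (Γ : MarkedGraph n V E) : Prop where
  connected : ∀ v, ∃ p, Γ.IsPath Γ.base p v
  no_free_edge : ∀ v, (Γ.star v).ncard ≠ 1
  valence : ∀ v, v ≠ Γ.base → 3 ≤ (Γ.star v).ncard
  mark_injective : Function.Injective Γ.mark
  mark_range : Set.range Γ.mark = {g | Γ.IsPath Γ.base g.toWord Γ.base}

open Classical in
/-- A pointed marked `G`-graph, for a subgroup `G` of `Aut(F_n)`: a pointed marked graph with an
action of `G` by automorphisms of the pointed graph which, through the marking, induces on `π₁` the
given action of `G` on `F_n`. (An action may invert edges.) -/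
structure IsMarkedGGraph (G : Subgroup (MulAut (FreeGroup (Fin n))))
    [MulAction G V] [MulAction G (Dart E)] (Γ : MarkedGraph n V E) : Prop
    extends Γ.IsMarkedGraph where
  smul_rev : ∀ (x : G) (d : Dart E), (x • d).rev = x • d.rev
  smul_term : ∀ (x : G) (d : Dart E), Γ.term (x • d) = x • Γ.term d
  smul_base : ∀ x : G, x • Γ.base = Γ.base
  equivariant : ∀ (x : G) (g : FreeGroup (Fin n)),
    (Γ.mark ((x : MulAut (FreeGroup (Fin n))) g)).toWord = (Γ.mark g).toWord.map (fun d => x • d)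

/-- A set of edges is a forest if it carries no nontrivial reduced closed edge path. -/
def IsForest (Γ : MarkedGraph n V E) (F : Set E) : Prop :=
  ∀ (v : V) (p : List (Dart E)), FreeGroup.IsReduced p → Γ.IsPath v p v →
    (∀ d ∈ p, d.1 ∈ F) → p = []

/-- A `G`-graph is reduced if it has no `G`-invariant forest with at least one edge. -/
def IsReducedGGraph (G : Type*) [Group G] [MulAction G (Dart E)] (Γ : MarkedGraph n V E) : Prop :=
  ∀ F : Set E, (∀ (x : G) (d : Dart E), d.1 ∈ F → (x • d).1 ∈ F) → Γ.IsForest F → F = ∅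

/-! ### Ideal edges -/

/-- `⋃ Gα`, the union of the translates of `α`. -/
def orbitUnion (G : Type*) [Group G] [MulAction G (Dart E)] (α : Set (Dart E)) : Set (Dart E) :=
  ⋃ x : G, x • α

/-- `D(α) = {a ∈ α : stab(a) = stab(α), ā ∉ ⋃ Gα}`. -/
def D (G : Type*) [Group G] [MulAction G (Dart E)] (α : Set (Dart E)) : Set (Dart E) :=
  {a | a ∈ α ∧ MulAction.stabilizer G a = MulAction.stabilizer G α ∧ a.rev ∉ orbitUnion G α}

/-- `α ⊆ E_v` is an ideal edge. -/
structure IsIdealEdge (G : Type*) [Group G] [MulAction G (Dart E)]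
    (Γ : MarkedGraph n V E) (v : V) (α : Set (Dart E)) : Prop where
  subset : α ⊆ Γ.star v
  two_le : 2 ≤ α.ncard
  compl_base : v = Γ.base → 1 ≤ (Γ.star v \ α).ncard
  compl_ne_base : v ≠ Γ.base → 2 ≤ (Γ.star v \ α).ncard
  translates : ∀ x : G, x • α = α ∨ Disjoint (x • α) α
  nonempty_D : (D G α).Nonempty

/-- The ideal edge `α ⊆ E_v` is invertible: `E_v - α` is not contained in `⋃ Gα`, and `E_v - α` is
an ideal edge. -/
def IsInvertible (G : Type*) [Group G] [MulAction G (Dart E)]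
    (Γ : MarkedGraph n V E) (v : V) (α : Set (Dart E)) : Prop :=
  ¬ (Γ.star v \ α ⊆ orbitUnion G α) ∧ Γ.IsIdealEdge G v (Γ.star v \ α)

/-! ### Loops, paths and counting -/

open Classical in
/-- The cyclically reduced edge path (well defined up to rotation) representing the conjugacy
class `c` under the marking, after applying the automorphism `x`. -/
def loopWord (Γ : MarkedGraph n V E) (x : MulAut (FreeGroup (Fin n)))
    (c : ConjClasses (FreeGroup (Fin n))) : List (Dart E) :=
  FreeGroup.reduceCyclically (Γ.mark (x (Quotient.out c))).toWord

open Classical in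
/-- The reduced (but not cyclically reduced) edge path representing `x g`. -/
def pathWord (Γ : MarkedGraph n V E) (x : MulAut (FreeGroup (Fin n)))
    (g : FreeGroup (Fin n)) : List (Dart E) :=
  (Γ.mark (x g)).toWord

end MarkedGraph

/-- Pairs of consecutive oriented edges of a cyclic word. -/
def cyclicTurns {E : Type*} (l : List (Dart E)) : List (Dart E × Dart E) := l.zip (l.rotate 1)

/-- Pairs of consecutive oriented edges of a path. -/
def pathTurns {E : Type*} (l : List (Dart E)) : List (Dart E × Dart E) := l.zip l.tail

open Classical in
/-- The number of times `d` or `d̄` occurs in `l`. -/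
def edgeCount {E : Type*} (l : List (Dart E)) (d : Dart E) : ℤ :=
  (l.countP (fun c => decide (c = d ∨ c = d.rev)) : ℕ)

open Classical in
/-- The number of times `a b̄` or `b ā`, with `a ∈ A` and `b ∈ B`, occurs in a list of turns. -/
def turnCount {E : Type*} (t : List (Dart E × Dart E)) (A B : Set (Dart E)) : ℤ :=
  (t.countP (fun p => decide ((p.1 ∈ A ∧ p.2.rev ∈ B) ∨ (p.1 ∈ B ∧ p.2.rev ∈ A))) : ℕ)

open Classical in
/-- The absolute value of a set of oriented edges, built from the absolute values `ab` of single
oriented edges and from the dot product `dot`: this is the function determined by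
`|{e}| = |e|` and `|A ∐ B| = |A| + |B| - 2 (A.B)` (see `setAbs_singleton`, `setAbs_union`). -/
def setAbs {E : Type*} [Fintype E] (ab : Dart E → ℤ) (dot : Set (Dart E) → Set (Dart E) → ℤ)
    (A : Set (Dart E)) : ℤ :=
  ∑ e ∈ A.toFinset, ab e - ∑ e ∈ A.toFinset, ∑ f ∈ A.toFinset.erase e, dot {e} {f}

namespace MarkedGraph

variable {n : ℕ} {V E : Type*} (G : Subgroup (MulAut (FreeGroup (Fin n)))) [Fintype G]

/-! In what follows `w` lists the conjugacy classes of `F_n` and `u` lists the elements of `F_n`;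
elements of `ℕ → ℤ` stand for elements of `ℤ^𝒲` and `ℤ^{F_n}`, coordinates being indexed by the
positions in the lists. -/

/-- `‖Γ‖_out`. -/
def outNorm (w : ℕ → ConjClasses (FreeGroup (Fin n))) (Γ : MarkedGraph n V E) : ℕ → ℤ :=
  fun i => ∑ x : G, ((Γ.loopWord x (w i)).length : ℤ)

/-- `|e|_out` for an oriented edge. -/
def outEdge (w : ℕ → ConjClasses (FreeGroup (Fin n))) (Γ : MarkedGraph n V E) (d : Dart E) :
    ℕ → ℤ :=
  fun i => ∑ x : G, edgeCount (Γ.loopWord x (w i)) d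

/-- `(A.B)_out`. -/
def outDot (w : ℕ → ConjClasses (FreeGroup (Fin n))) (Γ : MarkedGraph n V E)
    (A B : Set (Dart E)) : ℕ → ℤ :=
  fun i => ∑ x : G, turnCount (cyclicTurns (Γ.loopWord x (w i))) A B

/-- `|e|_aut` for an oriented edge. -/
def autEdge (u : ℕ → FreeGroup (Fin n)) (Γ : MarkedGraph n V E) (d : Dart E) : ℕ → ℤ :=
  fun i => ∑ x : G, edgeCount (Γ.pathWord x (u i)) d

/-- `(A.B)_aut`. -/
def autDot (u : ℕ → FreeGroup (Fin n)) (Γ : MarkedGraph n V E) (A B : Set (Dart E)) : ℕ → ℤ :=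
  fun i => ∑ x : G, turnCount (pathTurns (Γ.pathWord x (u i))) A B

variable [Fintype E]

/-- `|A|_out` for a set of oriented edges. -/
def outAbs (w : ℕ → ConjClasses (FreeGroup (Fin n))) (Γ : MarkedGraph n V E) (A : Set (Dart E)) :
    ℕ → ℤ :=
  fun i => setAbs (fun d => Γ.outEdge G w d i) (fun A B => Γ.outDot G w A B i) A

/-- `|A|_aut` for a set of oriented edges. -/
def autAbs (u : ℕ → FreeGroup (Fin n)) (Γ : MarkedGraph n V E) (A : Set (Dart E)) : ℕ → ℤ :=
  fun i => setAbs (fun d => Γ.autEdge G u d i) (fun A B => Γ.autDot G u A B i) A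

variable [MulAction G (Dart E)]

/-- `red_out(α, a) = [G : stab(α)] (|a|_out - |α|_out)`. -/
def redOut (w : ℕ → ConjClasses (FreeGroup (Fin n))) (Γ : MarkedGraph n V E)
    (α : Set (Dart E)) (a : Dart E) : ℕ → ℤ :=
  ((MulAction.stabilizer G α).index : ℤ) • (Γ.outEdge G w a - Γ.outAbs G w α)

/-- `red_aut(α, a) = [G : stab(α)] (|a|_aut - |α|_aut)`. -/
def redAut (u : ℕ → FreeGroup (Fin n)) (Γ : MarkedGraph n V E)
    (α : Set (Dart E)) (a : Dart E) : ℕ → ℤ :=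
  ((MulAction.stabilizer G α).index : ℤ) • (Γ.autEdge G u a - Γ.autAbs G u α)

/-- `red_tot(α, a) = [G : stab(α)] (|a|_tot - |α|_tot)`, where `|·|_tot = (|·|_out, |·|_aut)`, an
element of the lexicographic product of `ℤ^𝒲` and `ℤ^{F_n}`, each ordered lexicographically. -/
def redTot (w : ℕ → ConjClasses (FreeGroup (Fin n))) (u : ℕ → FreeGroup (Fin n))
    (Γ : MarkedGraph n V E) (α : Set (Dart E)) (a : Dart E) :
    Lex (ℕ → ℤ) ×ₗ Lex (ℕ → ℤ) :=
  toLex (toLex (Γ.redOut G w α a), toLex (Γ.redAut G u α a))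

/-- `α` is tot-reductive: its tot-reductivity, i.e. the maximum of `red_tot(α, a)` over
`a ∈ D(α)`, is greater than zero. -/
def IsTotReductive (w : ℕ → ConjClasses (FreeGroup (Fin n))) (u : ℕ → FreeGroup (Fin n))
    (Γ : MarkedGraph n V E) (α : Set (Dart E)) : Prop :=
  ∃ r, IsGreatest ((fun a => Γ.redTot G w u α a) '' D G α) r ∧ 0 < r

end MarkedGraph

/-! ### Blowing up, collapsing, Whitehead moves -/

namespace MarkedGraph

variable {n : ℕ} {V E : Type*}

open Classical in
/-- The word to be appended, in the blow-up along the family `S` of disjoint sets of oriented edges,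
to the oriented edge `d`: the new edge `e(β)` if `d` lies in a member `β` of `S`, and nothing
otherwise. -/
def newEdge (S : Set (Set (Dart E))) (d : Dart E) : FreeGroup (E ⊕ S) :=
  if h : ∃ β : S, d ∈ β.1 then FreeGroup.of (Sum.inr h.choose) else 1

open Classical in
/-- Terminal vertex in the blow-up along `S`. For each `β ∈ S` there is a new vertex `inr β` and a
new edge `e(β)`, which runs from `inr β` to the vertex at which the members of `β` used to end; the
members of `β` now end at `inr β`. -/
def blowUpTerm (Γ : MarkedGraph n V E) (S : Set (Set (Dart E))) : Dart (E ⊕ S) → V ⊕ S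
  | (Sum.inl e, b) => if h : ∃ β : S, (e, b) ∈ β.1 then Sum.inr h.choose else Sum.inl (Γ.term (e, b))
  | (Sum.inr β, true) =>
      Sum.inl (if h : (β.1).Nonempty then Γ.term h.some else Γ.base)
  | (Sum.inr β, false) => Sum.inr β

/-- The result of blowing up the members of the family `S` of pairwise disjoint sets of oriented
edges, each contained in some `E_v`. -/
def blowUp (Γ : MarkedGraph n V E) (S : Set (Set (Dart E))) : MarkedGraph n (V ⊕ S) (E ⊕ S) where
  term := Γ.blowUpTerm S
  base := Sum.inl Γ.base
  mark := (FreeGroup.lift (fun e : E =>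
    (newEdge S (e, false))⁻¹ * FreeGroup.of (Sum.inl e) * newEdge S (e, true))).comp Γ.mark

open Classical in
/-- The result of collapsing the edges in `F` (meant for a forest `F`): the endpoints of the members
of `F` are identified, and the members of `F` are deleted from the graph and from the paths. -/
def collapse (Γ : MarkedGraph n V E) (F : Set E) :
    MarkedGraph n (Quot (fun p q : V => ∃ e ∈ F, Γ.term (e, false) = p ∧ Γ.term (e, true) = q))
      {e : E // e ∉ F} where
  term := fun d => Quot.mk _ (Γ.term (d.1.1, d.2))
  base := Quot.mk _ Γ.base
  mark := (FreeGroup.lift (fun e : E =>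
    if h : e ∈ F then (1 : FreeGroup {e : E // e ∉ F}) else FreeGroup.of ⟨e, h⟩)).comp Γ.mark

/-- The Whitehead move `(Gα, Ga)`: blow up the orbit of `α`, then collapse the orbit of `a`. -/
def whitehead (G : Type*) [Group G] [MulAction G (Dart E)] (Γ : MarkedGraph n V E)
    (α : Set (Dart E)) (a : Dart E) :=
  (Γ.blowUp (MulAction.orbit G α)).collapse {e | ∃ x : G, e = Sum.inl (x • a).1}

end MarkedGraph

/-! ### The absolute value of a set satisfies its defining formulas -/

theorem setAbs_singleton {E : Type*} [Fintype E] (ab : Dart E → ℤ)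
    (dot : Set (Dart E) → Set (Dart E) → ℤ) (e : Dart E) : setAbs ab dot {e} = ab e := by
  classical
  simp [setAbs]

theorem turnCount_symm {E : Type*} (t : List (Dart E × Dart E)) (A B : Set (Dart E)) :
    turnCount t A B = turnCount t B A := by
  unfold turnCount
  congr 1
  exact List.countP_congr fun p _ => by simp only [decide_eq_true_eq]; exact or_comm

open Classical in
theorem turnCount_eq_sum {E : Type*} [Fintype E] (t : List (Dart E × Dart E))
    (A B : Set (Dart E)) (h : Disjoint A B) :
    turnCount t A B = ∑ e ∈ A.toFinset, ∑ f ∈ B.toFinset, turnCount t {e} {f} := by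
  induction t with
  | nil => simp [turnCount]
  | cons p t ih =>
    have key : ∀ C D : Set (Dart E), turnCount (p :: t) C D = turnCount t C D +
        if (p.1 ∈ C ∧ p.2.rev ∈ D) ∨ (p.1 ∈ D ∧ p.2.rev ∈ C) then 1 else 0 := by
      intro C D
      simp only [turnCount, List.countP_cons, decide_eq_true_eq]
      split_ifs <;> simp
    have split : ∀ C D : Set (Dart E), Disjoint C D →
        (if (p.1 ∈ C ∧ p.2.rev ∈ D) ∨ (p.1 ∈ D ∧ p.2.rev ∈ C) then (1 : ℤ) else 0) =
        (if p.1 ∈ C then 1 else 0) * (if p.2.rev ∈ D then 1 else 0) +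
        (if p.1 ∈ D then 1 else 0) * (if p.2.rev ∈ C then 1 else 0) := by
      intro C D hCD
      have h1 : p.1 ∈ C → p.1 ∉ D := fun a b => Set.disjoint_left.1 hCD a b
      split_ifs <;> simp_all
    have sumI : ∀ (C : Set (Dart E)) (d : Dart E),
        ∑ e ∈ C.toFinset, (if d ∈ ({e} : Set (Dart E)) then (1 : ℤ) else 0) =
          if d ∈ C then 1 else 0 := by
      intro C d
      simp [Finset.sum_ite_eq]
    have rhs : ∑ e ∈ A.toFinset, ∑ f ∈ B.toFinset, turnCount (p :: t) {e} {f} =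
        ∑ e ∈ A.toFinset, ∑ f ∈ B.toFinset, (turnCount t {e} {f} +
          ((if p.1 ∈ ({e} : Set (Dart E)) then 1 else 0) *
              (if p.2.rev ∈ ({f} : Set (Dart E)) then 1 else 0) +
            (if p.2.rev ∈ ({e} : Set (Dart E)) then 1 else 0) *
              (if p.1 ∈ ({f} : Set (Dart E)) then 1 else 0))) := by
      refine Finset.sum_congr rfl fun e he => Finset.sum_congr rfl fun f hf => ?_
      have hef : Disjoint ({e} : Set (Dart E)) {f} := by
        rw [Set.disjoint_singleton]
        rintro rfl
        exact Set.disjoint_left.1 h (by simpa using he) (by simpa using hf)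
      rw [key, split _ _ hef]
      ring_nf
    rw [rhs, key, ih, split _ _ h]
    simp only [Finset.sum_add_distrib, ← Finset.mul_sum, ← Finset.sum_mul, sumI]
    ring

/-- `|A ∐ B| = |A| + |B| - 2 (A.B)` for disjoint `A` and `B`. -/
theorem setAbs_union {E X : Type*} [Fintype E] [Fintype X] (ab : Dart E → ℤ)
    (t : X → List (Dart E × Dart E)) (A B : Set (Dart E)) (h : Disjoint A B) :
    setAbs ab (fun A B => ∑ x, turnCount (t x) A B) (A ∪ B) =
      setAbs ab (fun A B => ∑ x, turnCount (t x) A B) A +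
      setAbs ab (fun A B => ∑ x, turnCount (t x) A B) B -
      2 * ∑ x, turnCount (t x) A B := by
  classical
  have hd : Disjoint A.toFinset B.toFinset := by simpa using h
  have hdot : ∑ x, turnCount (t x) A B =
      ∑ e ∈ A.toFinset, ∑ f ∈ B.toFinset, ∑ x, turnCount (t x) {e} {f} := by
    simp only [turnCount_eq_sum _ A B h]
    rw [Finset.sum_comm]
    exact Finset.sum_congr (by simp) fun e _ => by rw [Finset.sum_comm]
  have hsymm : ∑ f ∈ B.toFinset, ∑ e ∈ A.toFinset, ∑ x, turnCount (t x) {f} {e} =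
      ∑ x, turnCount (t x) A B := by
    rw [hdot, Finset.sum_comm]
    exact Finset.sum_congr rfl fun e _ => Finset.sum_congr rfl fun f _ =>
      Finset.sum_congr rfl fun x _ => turnCount_symm _ _ _
  have e1 : ∀ e ∈ A.toFinset, ∑ f ∈ (A.toFinset ∪ B.toFinset).erase e,
      ∑ x, turnCount (t x) {e} {f} = ∑ f ∈ A.toFinset.erase e, ∑ x, turnCount (t x) {e} {f} +
        ∑ f ∈ B.toFinset, ∑ x, turnCount (t x) {e} {f} := by
    intro e he
    have heB : e ∉ B.toFinset := Finset.disjoint_left.1 hd he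
    rw [Finset.erase_union_distrib, Finset.erase_eq_of_notMem heB, Finset.sum_union]
    exact hd.mono_left (Finset.erase_subset _ _)
  have e2 : ∀ e ∈ B.toFinset, ∑ f ∈ (A.toFinset ∪ B.toFinset).erase e,
      ∑ x, turnCount (t x) {e} {f} = ∑ f ∈ B.toFinset.erase e, ∑ x, turnCount (t x) {e} {f} +
        ∑ f ∈ A.toFinset, ∑ x, turnCount (t x) {e} {f} := by
    intro e he
    have heA : e ∉ A.toFinset := Finset.disjoint_right.1 hd he
    rw [Finset.erase_union_distrib, Finset.erase_eq_of_notMem heA, Finset.sum_union, add_comm]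
    exact hd.mono_right (Finset.erase_subset _ _)
  have hU : (A ∪ B).toFinset = A.toFinset ∪ B.toFinset := by ext; simp
  have main : setAbs ab (fun A B => ∑ x, turnCount (t x) A B) (A ∪ B) =
      ∑ e ∈ A.toFinset ∪ B.toFinset, ab e - ∑ e ∈ A.toFinset ∪ B.toFinset,
        ∑ f ∈ (A.toFinset ∪ B.toFinset).erase e, ∑ x, turnCount (t x) {e} {f} := by
    unfold setAbs
    rw [← hU]
    congr!
  rw [main, Finset.sum_union hd, Finset.sum_union hd, Finset.sum_congr rfl e1,
    Finset.sum_congr rfl e2, Finset.sum_add_distrib, Finset.sum_add_distrib, ← hdot, hsymm]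
  unfold setAbs
  ring_nf

end AuterSpace

end

open AuterSpace

noncomputable section

namespace AuterSpace

/-! ### Reduced and cyclically reduced words. -/

section Words

variable {E : Type*}

/-! The natural competitor for `a ∈ D(α)` is a translate of `ā`. Invertibility forces the
stabilizers of `α`, of `α⁻¹ = E_v - α` and of `v` to coincide (`stabilizer_eq`,
`stabilizer_star_diff`). Hence `stab(a) = stab(v)`, and if `a` started outside the orbit of `v`, its
orbit would be a disjoint union of stars, an invariant forest (`isForest_orbit`). As the graph is
reduced, some `y • ā` ends at `v`, and it lies in `D(α⁻¹)` (`smul_rev_mem_D`).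

A cyclic loop contributes to `|A|_out` the sum of `(ind A d - ind A ē)²` over its turns `d, e`
(`wordAbs_cyclicTurns`). For `A ⊆ E_v` this counts the turns separating `A` from the rest of `E_v`,
so it is the same for `α` and `α⁻¹`, and `red_out(α⁻¹, y • ā) = red_out(α, a)`. The same holds for
`red_aut` when `v ≠ *`, because paths based at `*` then have no endpoint at `v`.

At `v = *` the aut values may differ, but the out coordinate alone decides, since it is nonzero
(`redOut_ne_zero`). Indeed `G` fixes `*`, hence `α` and `a`, and `a` is a loop at `*`. The valence
condition yields a cyclically reduced loop that avoids `a` and has a turn between `α` and its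
complement (`exists_split_loop`). In the coordinate of its conjugacy class `|a|_out` is zero and
`|α|_out` is positive. The same class proves the claim on norms: blowing up inserts a letter at each
split turn, and collapsing `a` deletes nothing from a word that avoids `a` (`length_lt_whitehead`).
-/

@[simp] theorem Dart.rev_rev (d : Dart E) : Dart.rev d.rev = d := by
  simp [Dart.rev]

theorem Dart.rev_injective : Function.Injective (Dart.rev : Dart E → Dart E) :=
  Function.LeftInverse.injective Dart.rev_rev

theorem Dart.rev_eq_iff {d e : Dart E} : d.rev = e ↔ d = e.rev := by
  constructor
  · rintro rfl; simp
  · rintro rfl; simp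

theorem Dart.not_cancel_iff {d e : Dart E} : (d.1 = e.1 → d.2 = e.2) ↔ d ≠ e.rev := by
  obtain ⟨d, i⟩ := d
  obtain ⟨e, j⟩ := e
  cases i <;> cases j <;> simp [Dart.rev]

theorem Dart.fst_eq_iff {d e : Dart E} : d.1 = e.1 ↔ d = e ∨ d = e.rev := by
  obtain ⟨d, i⟩ := d
  obtain ⟨e, j⟩ := e
  cases i <;> cases j <;> simp [Dart.rev]

theorem isReduced_append_iff {l m : List (Dart E)} :
    FreeGroup.IsReduced (l ++ m) ↔ FreeGroup.IsReduced l ∧ FreeGroup.IsReduced m ∧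
      ∀ d ∈ l.getLast?, ∀ e ∈ m.head?, d ≠ e.rev := by
  simp only [FreeGroup.IsReduced, List.isChain_append, Dart.not_cancel_iff]

theorem isReduced_cons_iff {d : Dart E} {m : List (Dart E)} :
    FreeGroup.IsReduced (d :: m) ↔ FreeGroup.IsReduced m ∧ ∀ e ∈ m.head?, d ≠ e.rev := by
  have := isReduced_append_iff (l := [d]) (m := m)
  simpa using this

theorem isReduced_invRev {l : List (Dart E)} (h : FreeGroup.IsReduced l) :
    FreeGroup.IsReduced (FreeGroup.invRev l) := by
  classical
  rw [FreeGroup.isReduced_iff_reduce_eq, FreeGroup.reduce_invRev, h.reduce_eq]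

theorem isCyclicallyReduced_cons_iff {d : Dart E} {l : List (Dart E)} :
    FreeGroup.IsCyclicallyReduced (d :: l) ↔ FreeGroup.IsReduced (d :: l ++ [d]) := by
  rw [FreeGroup.IsCyclicallyReduced, isReduced_append_iff]
  simp only [Dart.not_cancel_iff]
  simp

theorem reduceCyclically_eq_self [DecidableEq E] {l : List (Dart E)}
    (h : FreeGroup.IsCyclicallyReduced l) : FreeGroup.reduceCyclically l = l := by
  induction l using List.bidirectionalRec
  case nil => simp
  case singleton => simp
  case cons_append a l b ih =>
    have := FreeGroup.isCyclicallyReduced_cons_append_iff.1 h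
    rw [FreeGroup.reduceCyclically.cons_append, if_neg]
    · rfl
    · rintro ⟨h1, h2⟩
      have := this.2 h1
      rw [this] at h2
      simp at h2

theorem reduceCyclically_conj [DecidableEq E] (c l : List (Dart E)) :
    FreeGroup.reduceCyclically (c ++ l ++ FreeGroup.invRev c) = FreeGroup.reduceCyclically l := by
  induction c with
  | nil => simp
  | cons d c ih =>
    rw [FreeGroup.invRev_cons]
    have : d :: c ++ l ++ (FreeGroup.invRev c ++ FreeGroup.invRev [d]) =
        d :: ((c ++ l ++ FreeGroup.invRev c) ++ [(d.1, !d.2)]) := by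
      simp [FreeGroup.invRev]
    rw [this, FreeGroup.reduceCyclically.cons_append]
    simpa using ih

theorem reduceCyclically_map {F : Type*} [DecidableEq E] [DecidableEq F]
    (f : Dart E → Dart F) (hf : Function.Injective f) (hrev : ∀ d, (f d).rev = f d.rev)
    (l : List (Dart E)) :
    FreeGroup.reduceCyclically (l.map f) = (FreeGroup.reduceCyclically l).map f := by
  induction l using List.bidirectionalRec
  case nil => simp
  case singleton => simp
  case cons_append a l b ih =>
    have key : ((f b).1 = (f a).1 ∧ (!(f b).2) = (f a).2) ↔ (b.1 = a.1 ∧ (!b.2) = a.2) := by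
      have h2 : ((f b).rev = f a) ↔ b.rev = a := by
        rw [hrev, hf.eq_iff]
      simpa [Dart.rev, Prod.ext_iff] using h2
    simp only [List.map_cons, List.map_append, List.map_nil,
      FreeGroup.reduceCyclically.cons_append, key]
    split_ifs
    · exact ih
    · simp

theorem IsCyclicallyReduced.rotate_one {d : Dart E} {l : List (Dart E)}
    (h : FreeGroup.IsCyclicallyReduced (d :: l)) : FreeGroup.IsCyclicallyReduced (l ++ [d]) := by
  cases l with
  | nil => simp
  | cons e l =>
    have h1 := isCyclicallyReduced_cons_iff.1 h
    refine ⟨h1.infix ⟨[d], [], by simp⟩, ?_⟩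
    intro x hx y hy
    rw [List.getLast?_concat] at hx
    simp only [Option.mem_def, Option.some.injEq, List.cons_append, List.head?_cons] at hx hy
    subst hx hy
    rw [Dart.not_cancel_iff]
    simp only [List.cons_append, isReduced_cons_iff] at h1
    simpa using h1.2

theorem IsCyclicallyReduced.rotate_last {d : Dart E} {l : List (Dart E)}
    (h : FreeGroup.IsCyclicallyReduced (l ++ [d])) : FreeGroup.IsCyclicallyReduced (d :: l) := by
  cases l with
  | nil => simp
  | cons e l =>
    rw [isCyclicallyReduced_cons_iff]
    have h1 := h.1
    have h2 := h.2 d (by rw [List.getLast?_concat]; rfl) e (by simp)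
    rw [Dart.not_cancel_iff] at h2
    rw [List.cons_append, isReduced_cons_iff]
    exact ⟨h1, by simpa using h2⟩

/-- The cyclic reduction of a conjugate of a cyclically reduced word is a rotation of the word. -/
theorem isRotated_reduceCyclically_conj [DecidableEq E] (c : List (Dart E)) :
    ∀ l : List (Dart E), FreeGroup.IsReduced c → FreeGroup.IsCyclicallyReduced l →
      (FreeGroup.reduceCyclically (FreeGroup.reduce (c ++ l ++ FreeGroup.invRev c))).IsRotated
        l := by
  induction c using List.reverseRecOn with
  | nil =>
    intro l _ hl
    simp [hl.isReduced.reduce_eq, reduceCyclically_eq_self hl, List.IsRotated.refl]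
  | append_singleton c d ih =>
    intro l hc hl
    have hc' : FreeGroup.IsReduced c := hc.infix ⟨[], [d], by simp⟩
    have step : ∀ m : List (Dart E),
        FreeGroup.mk ([d] ++ l ++ FreeGroup.invRev [d]) = FreeGroup.mk m →
        FreeGroup.reduce (c ++ [d] ++ l ++ FreeGroup.invRev (c ++ [d])) =
          FreeGroup.reduce (c ++ m ++ FreeGroup.invRev c) := by
      intro m hm
      apply FreeGroup.reduce.sound
      simp only [← FreeGroup.mul_mk, FreeGroup.invRev_append] at hm ⊢
      rw [← hm]
      simp only [mul_assoc]
    rcases l with _ | ⟨e, l⟩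
    · rw [step [] (FreeGroup.reduce.exact (by
        simp [FreeGroup.invRev, FreeGroup.reduce.cons]))]
      exact ih [] hc' hl
    -- Conjugating by the last letter `d` of `c` can cancel at the front or at the back of `l`.
    -- Either cancellation merely rotates `l`, which leaves the shorter conjugator `c`.
    by_cases h1 : d = e.rev
    · rw [step (l ++ [e]) ?_]
      · refine (ih (l ++ [e]) hc' (IsCyclicallyReduced.rotate_one hl)).trans ?_
        exact (List.IsRotated.symm ⟨1, by simp⟩)
      · have : d = (e.1, !e.2) := h1
        rw [this]
        have h2 : FreeGroup.invRev [(e.1, !e.2)] = [e] := by simp [FreeGroup.invRev]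
        have h3 : [(e.1, !e.2)] = FreeGroup.invRev [e] := by simp [FreeGroup.invRev]
        rw [h2, h3, ← List.singleton_append (l := l)]
        simp only [← FreeGroup.mul_mk, ← FreeGroup.inv_mk, inv_mul_cancel_left]
    obtain ⟨m, f, hm⟩ : ∃ m f, e :: l = m ++ [f] := by
      rcases List.eq_nil_or_concat (e :: l) with h | ⟨m, f, h⟩
      · simp at h
      · exact ⟨m, f, by simpa using h⟩
    by_cases h2 : f = d
    · subst h2
      rw [hm] at hl step ⊢
      rw [step (f :: m) ?_]
      · refine (ih (f :: m) hc' (IsCyclicallyReduced.rotate_last hl)).trans ⟨1, by simp⟩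
      · rw [← List.singleton_append (l := m)]
        simp only [← FreeGroup.mul_mk, ← FreeGroup.inv_mk, mul_assoc, mul_inv_cancel, mul_one]
    -- With no cancellation at either end the conjugate is already a reduced word, and cyclic
    -- reduction peels off the conjugator.
    · have hred : FreeGroup.IsReduced (c ++ [d] ++ (e :: l) ++ FreeGroup.invRev (c ++ [d])) := by
        rw [isReduced_append_iff, isReduced_append_iff]
        refine ⟨⟨hc, hl.1, ?_⟩, isReduced_invRev hc, ?_⟩
        · simpa using h1
        · rw [hm, ← List.append_assoc, List.getLast?_concat]
          rintro x hx y hy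
          simp only [Option.mem_def, Option.some.injEq, FreeGroup.invRev_append] at hx hy
          simp only [FreeGroup.invRev, List.map_cons, List.map_nil, List.reverse_cons,
            List.reverse_nil, List.nil_append, List.cons_append, List.head?_cons,
            Option.some.injEq] at hy
          subst hx hy
          simpa [Dart.rev] using h2
      rw [hred.reduce_eq, reduceCyclically_conj, reduceCyclically_eq_self hl]

theorem isRotated_reduceCyclically_toWord_of_isConj [DecidableEq E] {g : FreeGroup E}
    {l : List (Dart E)} (hl : FreeGroup.IsCyclicallyReduced l)
    (h : IsConj (FreeGroup.mk l) g) : (FreeGroup.reduceCyclically g.toWord).IsRotated l := by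
  obtain ⟨c, rfl⟩ := isConj_iff.1 h
  have := isRotated_reduceCyclically_conj c.toWord l FreeGroup.isReduced_toWord hl
  rw [← FreeGroup.toWord_mk, ← FreeGroup.mul_mk, ← FreeGroup.mul_mk, ← FreeGroup.inv_mk,
    FreeGroup.mk_toWord] at this
  exact this

theorem isRotated_cyclicTurns {l m : List (Dart E)} (h : l.IsRotated m) :
    (cyclicTurns l).IsRotated (cyclicTurns m) := by
  obtain ⟨n, rfl⟩ := h
  refine ⟨n, ?_⟩
  simp only [cyclicTurns, List.zip]
  rw [List.zipWith_rotate_distrib _ _ _ _ (by simp), List.rotate_rotate, List.rotate_rotate,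
    add_comm]

theorem ne_rev_of_mem_cyclicTurns {l : List (Dart E)} (h : FreeGroup.IsCyclicallyReduced l)
    {p : Dart E × Dart E} (hp : p ∈ cyclicTurns l) : p.1 ≠ p.2.rev := by
  cases l with
  | nil => simp [cyclicTurns] at hp
  | cons d l =>
    rw [isCyclicallyReduced_cons_iff] at h
    -- Decoupling the closing letter `z` from the head of the word allows induction on the word.
    have key : ∀ (z : Dart E) (l : List (Dart E)), FreeGroup.IsReduced (l ++ [z]) →
        ∀ p ∈ l.zip (l.tail ++ [z]), p.1 ≠ p.2.rev := by
      intro z l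
      induction l with
      | nil => simp
      | cons e l ih =>
        intro hl p hp
        cases l with
        | nil =>
          simp only [List.tail_cons, List.nil_append, List.zip_cons_cons, List.zip_nil_right,
            List.mem_singleton] at hp
          subst hp
          rw [List.cons_append, isReduced_cons_iff] at hl
          exact hl.2 z (by simp)
        | cons f l =>
          rw [List.cons_append, isReduced_cons_iff] at hl
          simp only [List.tail_cons, List.cons_append, List.zip_cons_cons, List.mem_cons] at hp
          rcases hp with rfl | hp
          · exact hl.2 f (by simp)
          · exact ih hl.1 p (by simpa using hp)
    exact key d (d :: l) h p (by simpa [cyclicTurns] using hp)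

theorem ne_rev_of_mem_pathTurns {l : List (Dart E)} (h : FreeGroup.IsReduced l)
    {p : Dart E × Dart E} (hp : p ∈ pathTurns l) : p.1 ≠ p.2.rev := by
  induction l with
  | nil => simp [pathTurns] at hp
  | cons e l ih =>
    rw [isReduced_cons_iff] at h
    cases l with
    | nil => simp [pathTurns] at hp
    | cons f l =>
      simp only [pathTurns, List.tail_cons, List.zip_cons_cons, List.mem_cons] at hp
      rcases hp with rfl | hp
      · exact h.2 f (by simp)
      · exact ih h.1 hp

end Words

/-! ### Absolute values as sums over the turns of a word. -/

section Counting

variable {E : Type*}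

open Classical in
/-- The integer-valued indicator function of a set of oriented edges. -/
def ind (A : Set (Dart E)) (d : Dart E) : ℤ := if d ∈ A then 1 else 0

theorem ind_mul_self (A : Set (Dart E)) (d : Dart E) : ind A d * ind A d = ind A d := by
  unfold ind
  split_ifs <;> simp

theorem ind_congr {A B : Set (Dart E)} {c d : Dart E} (h : c ∈ A ↔ d ∈ B) :
    ind A c = ind B d := by
  unfold ind
  by_cases h' : d ∈ B
  · rw [if_pos h', if_pos (h.2 h')]
  · rw [if_neg h', if_neg fun hc => h' (h.1 hc)]

theorem Dart.rev_ne (d : Dart E) : d.rev ≠ d := by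
  simp [Dart.rev, Prod.ext_iff]

theorem edgeCount_rev (l : List (Dart E)) (d : Dart E) : edgeCount l d.rev = edgeCount l d := by
  classical
  unfold edgeCount
  congr 1
  exact List.countP_congr fun p _ => by simp only [decide_eq_true_eq, Dart.rev_rev]; exact or_comm

theorem edgeCount_map (f : Dart E → Dart E) (hf : Function.Injective f)
    (hrev : ∀ d, (f d).rev = f d.rev) (l : List (Dart E)) (d : Dart E) :
    edgeCount (l.map f) (f d) = edgeCount l d := by
  classical
  unfold edgeCount
  rw [List.countP_map]
  congr 1
  exact List.countP_congr fun p _ => by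
    simp only [Function.comp, decide_eq_true_eq, hrev, hf.eq_iff]

theorem edgeCount_eq_zero {l : List (Dart E)} {d : Dart E} (h : ∀ c ∈ l, c.1 ≠ d.1) :
    edgeCount l d = 0 := by
  classical
  unfold edgeCount
  rw [Nat.cast_eq_zero, List.countP_eq_zero]
  intro c hc
  rw [decide_eq_true_eq, ← Dart.fst_eq_iff]
  exact h c hc

theorem sum_edgeCount [Fintype E] (l : List (Dart E)) (A : Finset (Dart E)) :
    ∑ e ∈ A, edgeCount l e =
      (l.map fun d => ind (A : Set (Dart E)) d + ind (A : Set (Dart E)) d.rev).sum := by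
  classical
  induction l with
  | nil => simp [edgeCount]
  | cons c l ih =>
    have h : ∀ e, edgeCount (c :: l) e =
        edgeCount l e + ((if e = c then 1 else 0) + if e = c.rev then 1 else 0) := by
      intro e
      unfold edgeCount
      rw [List.countP_cons]
      have := Dart.rev_ne c
      by_cases h1 : e = c
      · subst h1; simp [this.symm]
      · by_cases h2 : e = c.rev
        · subst h2; simp [this]
        · have : ¬ c = e.rev := fun h => h2 (by simp [h])
          simp [h1, h2, this, Ne.symm h1]
    simp only [h, Finset.sum_add_distrib, ih, List.map_cons, List.sum_cons, Finset.sum_ite_eq', ind,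
      Finset.mem_coe]
    ring

/-- A turn inside `A` is seen by two ordered pairs `(e, f)`, whence the factor 2. Absence of
backtracking ensures that neither pair lies on the diagonal removed by `erase`. -/
theorem sum_turnCount [Fintype E] (t : List (Dart E × Dart E)) (ht : ∀ p ∈ t, p.1 ≠ p.2.rev)
    (A : Finset (Dart E)) [DecidableEq (Dart E)] :
    ∑ e ∈ A, ∑ f ∈ A.erase e, turnCount t {e} {f} =
      2 * (t.map fun p => ind (A : Set (Dart E)) p.1 * ind (A : Set (Dart E)) p.2.rev).sum := by
  classical
  induction t with
  | nil => simp [turnCount]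
  | cons c t ih =>
    have hc := ht c (by simp)
    have h : ∀ e, ∀ f ∈ A.erase e, turnCount (c :: t) {e} {f} =
        turnCount t {e} {f} + ((if e = c.1 then (if f = c.2.rev then 1 else 0) else 0) +
          if e = c.2.rev then (if f = c.1 then 1 else 0) else 0) := by
      intro e f hf
      unfold turnCount
      rw [List.countP_cons]
      simp only [Set.mem_singleton_iff]
      have hef : f ≠ e := (Finset.mem_erase.1 hf).1
      by_cases h1 : e = c.1
      · subst h1
        simp only [hc]
        by_cases h2 : f = c.2.rev
        · subst h2; simp
        · simp [h2, Ne.symm h2, hc.symm]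
      · by_cases h2 : e = c.2.rev
        · subst h2
          by_cases h3 : f = c.1
          · subst h3; simp [h1]
          · simp [h1, h3, Ne.symm h3, Ne.symm h1]
        · simp [h1, h2, Ne.symm h1, Ne.symm h2]
    have h' : ∑ e ∈ A, ∑ f ∈ A.erase e, turnCount (c :: t) {e} {f} =
        ∑ e ∈ A, ∑ f ∈ A.erase e, (turnCount t {e} {f} +
          ((if e = c.1 then (if f = c.2.rev then 1 else 0) else 0) +
          if e = c.2.rev then (if f = c.1 then 1 else 0) else 0)) :=
      Finset.sum_congr rfl fun e _ => Finset.sum_congr rfl fun f hf => h e f hf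
    rw [h']
    have k : ∀ x y : Dart E, x ≠ y → ∑ e ∈ A, ∑ f ∈ A.erase e,
        (if e = x then (if f = y then (1 : ℤ) else 0) else 0) =
          ind (A : Set (Dart E)) x * ind (A : Set (Dart E)) y := by
      intro x y hxy
      have : ∀ e ∈ A, ∑ f ∈ A.erase e, (if e = x then (if f = y then (1 : ℤ) else 0) else 0) =
          if e = x then ind (A : Set (Dart E)) y else 0 := by
        intro e _
        split_ifs with he
        · subst he
          simp [ind, Finset.mem_erase, hxy.symm]
        · simp
      rw [Finset.sum_congr rfl this]
      by_cases hx : x ∈ A <;> simp [ind, hx]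
    simp only [Finset.sum_add_distrib, k _ _ hc, k _ _ hc.symm,
      ih fun p hp => ht p (List.mem_cons_of_mem _ hp), List.map_cons, List.sum_cons]
    ring

/-- The contribution of a word with list of turns `t` to the absolute value of `A`. -/
def wordAbs (l : List (Dart E)) (t : List (Dart E × Dart E)) (A : Set (Dart E)) : ℤ :=
  (l.map fun d => ind A d + ind A d.rev).sum -
    2 * (t.map fun p => ind A p.1 * ind A p.2.rev).sum

theorem setAbs_eq_sum [Fintype E] {X : Type*} [Fintype X] (l : X → List (Dart E))
    (t : X → List (Dart E × Dart E)) (ht : ∀ x, ∀ p ∈ t x, p.1 ≠ p.2.rev) (A : Set (Dart E)) :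
    setAbs (fun d => ∑ x, edgeCount (l x) d) (fun A B => ∑ x, turnCount (t x) A B) A =
      ∑ x, wordAbs (l x) (t x) A := by
  classical
  unfold setAbs wordAbs
  rw [Finset.sum_comm, Finset.sum_sub_distrib]
  congr 1
  · refine Finset.sum_congr rfl fun x _ => ?_
    rw [sum_edgeCount]
    simp
  · have : ∀ e ∈ A.toFinset, ∑ f ∈ A.toFinset.erase e, ∑ x, turnCount (t x) {e} {f} =
        ∑ x, ∑ f ∈ A.toFinset.erase e, turnCount (t x) {e} {f} := fun e _ => Finset.sum_comm
    rw [Finset.sum_congr rfl this, Finset.sum_comm]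
    refine Finset.sum_congr rfl fun x _ => ?_
    rw [sum_turnCount _ (ht x)]
    simp

/-- In a cyclic word each letter is the first entry of one turn and the second entry of another, so
the sum over letters becomes a sum over turns. Idempotence of indicators then turns `x + y - 2xy`
into `(x - y)²`. -/
theorem wordAbs_cyclicTurns (l : List (Dart E)) (A : Set (Dart E)) :
    wordAbs l (cyclicTurns l) A =
      ((cyclicTurns l).map fun p => (ind A p.1 - ind A p.2.rev) ^ 2).sum := by
  have h1 : l.map (ind A) = (cyclicTurns l).map fun p => ind A p.1 := by
    have : (cyclicTurns l).map Prod.fst = l := List.map_fst_zip (by simp)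
    conv_lhs => rw [← this]
    simp [Function.comp_def]
  have h2 : (l.map fun d => ind A d.rev).sum =
      ((cyclicTurns l).map fun p => ind A p.2.rev).sum := by
    have : (cyclicTurns l).map Prod.snd = l.rotate 1 := List.map_snd_zip (by simp)
    have h3 : ((l.rotate 1).map fun d => ind A d.rev).sum = (l.map fun d => ind A d.rev).sum :=
      ((List.rotate_perm l 1).map _).sum_eq
    rw [← h3, ← this]
    simp [Function.comp_def]
  unfold wordAbs
  rw [List.sum_map_add, h2, show (l.map fun d => ind A d) = _ from h1]
  induction cyclicTurns l with
  | nil => simp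
  | cons p t ih =>
    simp only [List.map_cons, List.sum_cons]
    linear_combination ih - ind_mul_self A p.1 - ind_mul_self A p.2.rev

end Counting

/-! ### Edge paths, and absolute values of complementary subsets of a star. -/

namespace MarkedGraph

variable {n : ℕ} {V E : Type*} {Γ : MarkedGraph n V E}

section Paths

@[simp] theorem init_rev (d : Dart E) : Γ.init d.rev = Γ.term d := by simp [init]

@[simp] theorem term_rev (d : Dart E) : Γ.term d.rev = Γ.init d := rfl

theorem isPath_append {p q : List (Dart E)} {a b : V} :
    Γ.IsPath a (p ++ q) b ↔ ∃ c, Γ.IsPath a p c ∧ Γ.IsPath c q b := by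
  induction p generalizing a with
  | nil => simp [IsPath]
  | cons d p ih => simp [IsPath, ih, and_assoc]

theorem isPath_singleton {d : Dart E} {a b : V} :
    Γ.IsPath a [d] b ↔ Γ.init d = a ∧ Γ.term d = b := by simp [IsPath]

theorem IsPath.unique {p : List (Dart E)} {a b c : V} (h : Γ.IsPath a p b) (h' : Γ.IsPath a p c) :
    b = c := by
  induction p generalizing a with
  | nil => exact Eq.trans (Eq.symm h) h'
  | cons d p ih => exact ih h.2 h'.2

theorem IsPath.invRev {p : List (Dart E)} {a b : V} (h : Γ.IsPath a p b) :
    Γ.IsPath b (FreeGroup.invRev p) a := by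
  induction p generalizing a with
  | nil => exact Eq.symm h
  | cons d p ih =>
    rw [FreeGroup.invRev_cons, isPath_append]
    refine ⟨Γ.term d, ih h.2, ?_⟩
    have : FreeGroup.invRev [d] = [d.rev] := by simp [FreeGroup.invRev, Dart.rev]
    rw [this, isPath_singleton]
    exact ⟨by simp, h.1⟩

/-- The path factors as `c`, its cyclic reduction, and the reverse of `c`; the middle part begins
and ends at the endpoint of `c`. -/
theorem IsPath.exists_reduceCyclically [DecidableEq E] {p : List (Dart E)} {a : V}
    (h : Γ.IsPath a p a) :
    ∃ b, Γ.IsPath b (FreeGroup.reduceCyclically p) b := by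
  rw [← FreeGroup.reduceCyclically.conj_conjugator_reduceCyclically p, isPath_append] at h
  obtain ⟨c, h1, h2⟩ := h
  obtain ⟨b, h3, h4⟩ := isPath_append.1 h1
  have h5 := h2.invRev
  rw [FreeGroup.invRev_invRev] at h5
  obtain rfl := h3.unique h5
  exact ⟨b, h4⟩

theorem IsPath.term_eq_init {l : List (Dart E)} {a b : V} (h : Γ.IsPath a l b) {z : Dart E}
    (hz : Γ.init z = b) {p : Dart E × Dart E} (hp : p ∈ l.zip (l.tail ++ [z])) :
    Γ.term p.1 = Γ.init p.2 := by
  induction l generalizing a with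
  | nil => simp at hp
  | cons e l ih =>
    cases l with
    | nil =>
      simp only [List.tail_cons, List.nil_append, List.zip_cons_cons, List.zip_nil_right,
        List.mem_singleton] at hp
      subst hp
      rw [isPath_singleton] at h
      exact h.2.trans hz.symm
    | cons f l =>
      simp only [List.tail_cons, List.cons_append, List.zip_cons_cons, List.mem_cons] at hp
      rcases hp with rfl | hp
      · exact h.2.1.symm
      · exact ih h.2 (by simpa using hp)

theorem IsPath.term_eq_init_of_mem_cyclicTurns {l : List (Dart E)} {a : V} (h : Γ.IsPath a l a)
    {p : Dart E × Dart E} (hp : p ∈ cyclicTurns l) : Γ.term p.1 = Γ.init p.2 := by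
  cases l with
  | nil => simp [cyclicTurns] at hp
  | cons d l => exact h.term_eq_init h.1 (by simpa [cyclicTurns] using hp)

theorem mem_star {v : V} {d : Dart E} : d ∈ Γ.star v ↔ Γ.term d = v := Iff.rfl

theorem ind_star_diff {v : V} {α : Set (Dart E)} (hα : α ⊆ Γ.star v) (d : Dart E) :
    ind (Γ.star v \ α) d = ind (Γ.star v) d - ind α d := by
  unfold ind
  by_cases h : d ∈ α
  · simp [h, hα h]
  · rw [if_neg h, sub_zero]
    exact ind_congr ⟨fun h' => h'.1, fun h' => ⟨h', h⟩⟩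

theorem ind_star_congr {v : V} {c d : Dart E} (h : Γ.term c = Γ.term d) :
    ind (Γ.star v) c = ind (Γ.star v) d :=
  ind_congr (by rw [mem_star, mem_star, h])

theorem ind_star_mul {v : V} {α : Set (Dart E)} (hα : α ⊆ Γ.star v) (d : Dart E) :
    ind (Γ.star v) d * ind α d = ind α d := by
  unfold ind
  by_cases h : d ∈ α
  · simp [h, hα h]
  · simp [h]

/-- The two oriented edges of a turn end at the same vertex, so passing to the complement in `E_v`
only changes the sign of each difference of indicators. -/
theorem IsPath.wordAbs_star_diff {l : List (Dart E)} {a v : V} {α : Set (Dart E)}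
    (hα : α ⊆ Γ.star v) (h : Γ.IsPath a l a) :
    wordAbs l (cyclicTurns l) (Γ.star v \ α) = wordAbs l (cyclicTurns l) α := by
  rw [wordAbs_cyclicTurns, wordAbs_cyclicTurns]
  congr 1
  refine List.map_congr_left fun p hp => ?_
  rw [ind_star_diff hα, ind_star_diff hα,
    ind_star_congr (d := p.2.rev) (h.term_eq_init_of_mem_cyclicTurns hp)]
  ring

theorem ind_eq_zero_of_term_ne {v : V} {α : Set (Dart E)} (hα : α ⊆ Γ.star v) {d : Dart E}
    (h : Γ.term d ≠ v) : ind α d = 0 := by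
  unfold ind
  rw [if_neg]
  exact fun h' => h (hα h')

/-- A path differs from a cyclic word by two unpaired indicator terms, at its two ends. They vanish
because neither endpoint is `v`. -/
theorem IsPath.wordAbs_pathTurns_star_diff {l : List (Dart E)} {a b v : V} {α : Set (Dart E)}
    (hα : α ⊆ Γ.star v) (h : Γ.IsPath a l b) (ha : a ≠ v) (hb : b ≠ v) :
    wordAbs l (pathTurns l) (Γ.star v \ α) = wordAbs l (pathTurns l) α := by
  -- Subtracting the term of the first edge, which belongs to no turn yet, gives a quantity that can
  -- be followed as edges are prepended.
  have key : ∀ (l : List (Dart E)) (a : V) (d : Dart E), Γ.IsPath a (d :: l) b →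
      wordAbs (d :: l) (pathTurns (d :: l)) (Γ.star v \ α) - ind (Γ.star v \ α) d.rev =
        wordAbs (d :: l) (pathTurns (d :: l)) α - ind α d.rev := by
    intro l
    induction l with
    | nil =>
      intro a d h
      rw [isPath_singleton] at h
      have hd : Γ.term d ≠ v := by rw [h.2]; exact hb
      simp [wordAbs, pathTurns, ind_eq_zero_of_term_ne hα hd,
        ind_eq_zero_of_term_ne (Set.sdiff_subset : Γ.star v \ α ⊆ Γ.star v) hd]
    | cons e l ih =>
      intro a d h
      have h1 := ih _ e h.2
      have h2 : ind (Γ.star v) d = ind (Γ.star v) e.rev := ind_star_congr h.2.1.symm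
      have h3 := ind_star_diff hα d
      have h4 := ind_star_diff hα e.rev
      simp only [wordAbs, pathTurns, List.tail_cons, List.zip_cons_cons, List.map_cons,
        List.sum_cons] at h1 ⊢
      have h5 := ind_star_mul hα d
      have h6 := ind_star_mul hα e.rev
      have h7 := ind_mul_self (Γ.star v) e.rev
      rw [h2] at h3 h5
      rw [h4] at h1
      rw [h3, h4]
      linear_combination h1 - 2 * h7 + 2 * h5 + 2 * h6
  cases l with
  | nil => simp [wordAbs, pathTurns]
  | cons d l =>
    have h1 := key l a d h
    have hd : Γ.term d.rev ≠ v := by rw [term_rev, h.1]; exact ha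
    rwa [ind_eq_zero_of_term_ne hα hd, ind_eq_zero_of_term_ne
      (Set.sdiff_subset : Γ.star v \ α ⊆ Γ.star v) hd, sub_zero, sub_zero] at h1

end Paths

end MarkedGraph

/-! ### Words after a blow-up: inserting a letter at split turns. -/

section Subdivision

variable {E X : Type*} (ι : E → X) (ε : X) (α : Set (Dart E))

open Classical in
/-- The word read off when an edge path of the blow-up leaves the new edge, labelled `ε`, right
after the oriented edge `d`. -/
def stem (d : Dart E) : FreeGroup X := if d ∈ α then FreeGroup.of ε else 1

open Classical in
/-- The word inserted by a blow-up of `α` into the turn `d, e`. -/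
def turnWord (d e : Dart E) : List (Dart X) :=
  if d ∈ α then (if e.rev ∈ α then [] else [(ε, true)])
  else if e.rev ∈ α then [(ε, false)] else []

/-- The word obtained from a word, to be followed by `z`, by relabelling its letters by `ι` and
inserting the words `turnWord`. -/
def insertWord (z : Dart E) : List (Dart E) → List (Dart X)
  | [] => []
  | d :: l => (ι d.1, d.2) :: (turnWord ε α d (l.headD z) ++ insertWord z l)

theorem mk_turnWord (d e : Dart E) :
    FreeGroup.mk (turnWord ε α d e) = stem ε α d * (stem ε α e.rev)⁻¹ := by
  unfold turnWord stem
  split_ifs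
  · simp [FreeGroup.one_eq_mk]
  · simp [FreeGroup.of]
  · simp [FreeGroup.of, FreeGroup.invRev]
  · simp [FreeGroup.one_eq_mk]

/-- The product telescopes: the stem after one letter and the inverse stem before the next combine
to the word inserted in their turn. Only the two outermost stems remain. -/
theorem mk_insertWord (θ : FreeGroup E →* FreeGroup X) (z : Dart E) (l : List (Dart E))
    (hθ : ∀ d ∈ l, θ (FreeGroup.mk [d]) =
      (stem ε α d.rev)⁻¹ * FreeGroup.mk [(ι d.1, d.2)] * stem ε α d) :
    θ (FreeGroup.mk l) =
      (stem ε α (l.headD z).rev)⁻¹ * FreeGroup.mk (insertWord ι ε α z l) * stem ε α z.rev := by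
  induction l with
  | nil => simp [insertWord, ← FreeGroup.one_eq_mk]
  | cons d l ih =>
    have h1 := hθ d (by simp)
    have h2 := ih fun e he => hθ e (List.mem_cons_of_mem _ he)
    have h3 : FreeGroup.mk (d :: l) = FreeGroup.mk [d] * FreeGroup.mk l := by simp
    have h4 : FreeGroup.mk (insertWord ι ε α z (d :: l)) = FreeGroup.mk [(ι d.1, d.2)] *
        (FreeGroup.mk (turnWord ε α d (l.headD z)) * FreeGroup.mk (insertWord ι ε α z l)) := by
      simp [insertWord]
    rw [h3, map_mul, h1, h2, h4, mk_turnWord]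
    simp only [List.headD_cons]
    group

/-- An inserted `ε` is flanked by letters other than `ε`, and letters that stay adjacent cancel no
more than before. The conditions on `ι` are confined to letters that occur, because a collapsed edge
has no genuine label. -/
theorem isReduced_insertWord (z : Dart E) (l : List (Dart E))
    (hι : ∀ d ∈ l ++ [z], ∀ e ∈ l ++ [z], ι d.1 = ι e.1 → d.1 = e.1)
    (hε : ∀ d ∈ l ++ [z], ι d.1 ≠ ε) (hl : FreeGroup.IsReduced (l ++ [z])) :
    FreeGroup.IsReduced (insertWord ι ε α z l ++ [(ι z.1, z.2)]) := by
  induction l with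
  | nil => simp [insertWord]
  | cons d l ih =>
    have h1 : ∃ m, insertWord ι ε α z l ++ [(ι z.1, z.2)] =
        (ι (l.headD z).1, (l.headD z).2) :: m := by
      cases l with
      | nil => exact ⟨[], rfl⟩
      | cons e l => exact ⟨_, rfl⟩
    have h0 : ∃ k, l ++ [z] = l.headD z :: k := by
      cases l with
      | nil => exact ⟨[], rfl⟩
      | cons e l => exact ⟨l ++ [z], rfl⟩
    have h2 := ih (fun d hd e he => hι d (List.mem_cons_of_mem _ hd) e (List.mem_cons_of_mem _ he))
      (fun d hd => hε d (List.mem_cons_of_mem _ hd)) (hl.infix ⟨[d], [], by simp⟩)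
    obtain ⟨m, hm⟩ := h1
    obtain ⟨k, hk⟩ := h0
    have hh : l.headD z ∈ d :: l ++ [z] := by
      rw [List.cons_append, hk]; simp
    have h3 : d.1 = (l.headD z).1 → d.2 = (l.headD z).2 := by
      rw [List.cons_append, hk] at hl
      exact (FreeGroup.isReduced_cons_cons.1 hl).1
    have h4 := hε d (by simp)
    have h5 := hε _ hh
    have h6 := hι d (by simp) _ hh
    simp only [insertWord, List.cons_append, List.append_assoc]
    rw [hm] at h2 ⊢
    unfold turnWord
    split_ifs <;> simp only [List.cons_append, List.nil_append, FreeGroup.isReduced_cons_cons]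
    · exact ⟨fun h => h3 (h6 h), h2⟩
    · exact ⟨fun h => absurd h h4, fun h => absurd h.symm h5, h2⟩
    · exact ⟨fun h => absurd h h4, fun h => absurd h.symm h5, h2⟩
    · exact ⟨fun h => h3 (h6 h), h2⟩

theorem length_insertWord (z d : Dart E) (l : List (Dart E)) (hd : ind α d ≠ ind α z.rev) :
    (l ++ [d]).length < (insertWord ι ε α z (l ++ [d])).length := by
  induction l with
  | nil =>
    have : (turnWord ε α d z).length = 1 := by
      unfold turnWord
      unfold ind at hd
      split_ifs at hd ⊢ <;> simp_all
    simp [insertWord, this]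
  | cons e l ih =>
    simp only [List.cons_append, insertWord, List.length_cons, List.length_append] at ih ⊢
    omega

/-- A homomorphism which acts on the letters of a cyclically reduced word by relabelling them and
inserting a letter into the turns between `α` and its complement increases the cyclic length, if
the closing turn is such a turn. -/
theorem length_lt_of_isConj [DecidableEq X] (θ : FreeGroup E →* FreeGroup X) (h d : Dart E)
    (l k : List (Dart E)) (hlk : h :: k = l ++ [d])
    (hl : FreeGroup.IsCyclicallyReduced (h :: k))
    (hθ : ∀ d ∈ h :: k, θ (FreeGroup.mk [d]) =
      (stem ε α d.rev)⁻¹ * FreeGroup.mk [(ι d.1, d.2)] * stem ε α d)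
    (hι : ∀ d ∈ h :: k, ∀ e ∈ h :: k, ι d.1 = ι e.1 → d.1 = e.1)
    (hε : ∀ d ∈ h :: k, ι d.1 ≠ ε) (hd : ind α d ≠ ind α h.rev)
    {g : FreeGroup E} (hg : IsConj (FreeGroup.mk (h :: k)) g) :
    (h :: k).length < (FreeGroup.reduceCyclically (θ g).toWord).length := by
  have hmem : ∀ e ∈ h :: k ++ [h], e ∈ h :: k := by
    intro e he
    simpa [or_comm] using he
  have h1 := mk_insertWord ι ε α θ h (h :: k) hθ
  have h2 := isReduced_insertWord ι ε α h (h :: k)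
    (fun d hd e he => hι d (hmem d hd) e (hmem e he)) (fun d hd => hε d (hmem d hd))
    (isCyclicallyReduced_cons_iff.1 hl)
  have h3 : FreeGroup.IsCyclicallyReduced (insertWord ι ε α h (h :: k)) := by
    unfold insertWord at h2 ⊢
    exact isCyclicallyReduced_cons_iff.2 h2
  have h4 : IsConj (FreeGroup.mk (insertWord ι ε α h (h :: k))) (θ g) := by
    -- When the word is closed up by its own first letter, the two outer stems are inverse to each
    -- other, so they amount to a conjugation.
    refine IsConj.trans ?_ (θ.map_isConj hg)
    rw [h1, isConj_iff]
    exact ⟨(stem ε α h.rev)⁻¹, by simp⟩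
  rw [(isRotated_reduceCyclically_toWord_of_isConj h3 h4).perm.length_eq, hlk]
  exact length_insertWord ι ε α h d l hd

end Subdivision

/-! ### Reduced loops at the basepoint that avoid a given loop edge. -/

namespace MarkedGraph

variable {n : ℕ} {V E : Type*} {Γ : MarkedGraph n V E}

section Loops

theorem IsPath.mem_map_init {l : List (Dart E)} {a b : V} (h : Γ.IsPath a l b) (hl : l ≠ []) :
    a ∈ l.map Γ.init := by
  cases l with
  | nil => exact absurd rfl hl
  | cons d l => simp [h.1]

/-- Cancellation at the new junction would require `p` and `q` to have the same last edge, which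
distinctness of the edges forbids. -/
theorem isReduced_lollipop {p q : List (Dart E)} (hpq : FreeGroup.IsReduced (p ++ q))
    (hq : q ≠ []) (hnd : (p ++ q).Nodup) :
    FreeGroup.IsReduced (p ++ q ++ FreeGroup.invRev p) := by
  rw [isReduced_append_iff]
  refine ⟨hpq, isReduced_invRev (hpq.infix ⟨[], q, by simp⟩), ?_⟩
  intro x hx y hy
  rcases List.eq_nil_or_concat p with rfl | ⟨p, d, rfl⟩
  · simp at hy
  · simp only [List.concat_eq_append, FreeGroup.invRev_append] at *
    have hy' : d.rev = y := by simpa [FreeGroup.invRev, Dart.rev] using hy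
    subst hy'
    rw [List.getLast?_append_of_ne_nil _ hq] at hx
    rintro rfl
    rw [Dart.rev_rev] at hx
    exact (List.nodup_append.1 hnd).2.2 d (by simp) d (List.mem_of_getLast? hx) rfl

variable [Finite V]

/-- Walk on from `y` without backtracking, as the valence condition permits, until a vertex repeats;
then return to the basepoint along the initial segment leading to that vertex. The number `k` bounds
the steps left, since the visited vertices are distinct. -/
theorem exists_reduced_extension (hΓ : Γ.IsMarkedGraph) {a d₀ : Dart E} (h₁ : Γ.init a = Γ.base)
    (h₂ : Γ.term a = Γ.base) (k : ℕ) :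
    ∀ (p : List (Dart E)) (y : V), Nat.card V ≤ p.length + k → Γ.IsPath Γ.base (d₀ :: p) y →
      FreeGroup.IsReduced (d₀ :: p) → (∀ d ∈ d₀ :: p, d.1 ≠ a.1) →
      ((d₀ :: p).map Γ.init ++ [y]).Nodup →
      ∃ q, Γ.IsPath Γ.base (d₀ :: q) Γ.base ∧ FreeGroup.IsReduced (d₀ :: q) ∧
        ∀ d ∈ d₀ :: q, d.1 ≠ a.1 := by
  classical
  have := Fintype.ofFinite V
  induction k with
  | zero =>
    intro p y hk _ _ _ hnd
    have := hnd.length_le_card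
    rw [Nat.card_eq_fintype_card] at hk
    simp at this
    omega
  | succ k ih =>
    intro p y hk hp hred ha hnd
    have hy : y ≠ Γ.base := by
      rintro rfl
      exact (List.nodup_append.1 hnd).2.2 _ (hp.mem_map_init (by simp)) _ (by simp) rfl
    have hval := hΓ.valence y hy
    obtain ⟨l, c, hlc⟩ : ∃ l c, d₀ :: p = l ++ [c] := by
      rcases List.eq_nil_or_concat (d₀ :: p) with h | ⟨m, f, h⟩
      · simp at h
      · exact ⟨m, f, by simpa using h⟩
    obtain ⟨e, he, hec⟩ : ∃ e ∈ Γ.star y, e ≠ c :=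
      Set.exists_ne_of_one_lt_ncard (by omega) c
    have he' : Γ.term e = y := he
    have hpe : Γ.IsPath Γ.base (d₀ :: p ++ [e.rev]) (Γ.init e) :=
      isPath_append.2 ⟨y, hp, isPath_singleton.2 ⟨by simp [he'], by simp⟩⟩
    have hrede : FreeGroup.IsReduced (d₀ :: p ++ [e.rev]) := by
      rw [isReduced_append_iff]
      refine ⟨hred, by simp, ?_⟩
      rw [hlc, List.getLast?_concat]
      simpa using hec.symm
    -- The new edge has an endpoint `y ≠ *`, whereas both ends of `a` are `*`.
    have hae : ∀ d ∈ d₀ :: p ++ [e.rev], d.1 ≠ a.1 := by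
      intro d hd
      rcases List.mem_append.1 hd with hd | hd
      · exact ha d hd
      · rw [List.mem_singleton] at hd
        subst hd
        intro h
        rcases Dart.fst_eq_iff.1 h with h | h
        · rw [Dart.rev_eq_iff] at h
          subst h
          exact hy (he'.symm.trans h₁)
        · rw [Dart.rev_injective h] at he'
          exact hy (he'.symm.trans h₂)
    have hmap : (d₀ :: p ++ [e.rev]).map Γ.init = (d₀ :: p).map Γ.init ++ [y] := by
      simp [he']
    by_cases hnew : Γ.init e ∈ (d₀ :: p ++ [e.rev]).map Γ.init
    · obtain ⟨f, hf, hfe⟩ := List.mem_map.1 hnew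
      obtain ⟨s, t, hst⟩ := List.append_of_mem hf
      have hnd' : (s ++ f :: t).Nodup := by
        rw [← hst]
        exact List.Nodup.of_map Γ.init (by rw [hmap]; exact hnd)
      rw [hst] at hpe hrede hae
      obtain ⟨x, hx, hx'⟩ := isPath_append.1 hpe
      have hxe : x = Γ.init e := by rw [← hfe]; exact hx'.1.symm
      have hloop : Γ.IsPath Γ.base (s ++ f :: t ++ FreeGroup.invRev s) Γ.base :=
        isPath_append.2 ⟨_, hpe, by rw [← hxe]; exact hx.invRev⟩
      have hredl := isReduced_lollipop hrede (by simp) hnd'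
      have hal : ∀ d ∈ s ++ f :: t ++ FreeGroup.invRev s, d.1 ≠ a.1 := by
        intro d hd
        rcases List.mem_append.1 hd with hd | hd
        · exact hae d hd
        · simp only [FreeGroup.invRev, List.mem_reverse, List.mem_map] at hd
          obtain ⟨d', hd', rfl⟩ := hd
          exact hae d' (List.mem_append_left _ hd')
      rw [← hst] at hloop hredl hal
      exact ⟨p ++ [e.rev] ++ FreeGroup.invRev s, by simpa using hloop, by simpa using hredl,
        by simpa using hal⟩
    · refine ih (p ++ [e.rev]) (Γ.init e)
        (by rw [List.length_append, List.length_singleton]; omega) hpe hrede hae ?_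
      rw [← List.cons_append, hmap] at *
      rw [List.nodup_append]
      refine ⟨hnd, by simp, ?_⟩
      intro x hx z hz
      rw [List.mem_singleton] at hz
      subst hz
      rintro rfl
      exact hnew hx

/-- Every oriented edge `d` starting at the basepoint is the first edge of a reduced loop at the
basepoint which avoids a given loop edge `a` different from `d` and `d̄`. -/
theorem exists_reduced_loop (hΓ : Γ.IsMarkedGraph) {a d : Dart E} (h₁ : Γ.init a = Γ.base)
    (h₂ : Γ.term a = Γ.base) (hd : Γ.init d = Γ.base) (hda : d.1 ≠ a.1) :
    ∃ q, Γ.IsPath Γ.base (d :: q) Γ.base ∧ FreeGroup.IsReduced (d :: q) ∧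
      ∀ e ∈ d :: q, e.1 ≠ a.1 := by
  by_cases h : Γ.term d = Γ.base
  · exact ⟨[], isPath_singleton.2 ⟨hd, h⟩, by simp, by simpa using hda⟩
  · refine exists_reduced_extension hΓ h₁ h₂ (Nat.card V) [] (Γ.term d) (by simp)
      (isPath_singleton.2 ⟨hd, rfl⟩) (by simp) (by simpa using hda) ?_
    simpa [hd] using Ne.symm h

/-- If `α` is a set of oriented edges ending at the basepoint, `a ∈ α`, `ā ∉ α` is an edge ending at
the basepoint, and both `α` and its complement contain another edge, then there is a cyclically
reduced loop which avoids `a` and whose closing turn goes between `α` and its complement. -/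
theorem exists_split_loop (hΓ : Γ.IsMarkedGraph) {α : Set (Dart E)} {a p q : Dart E}
    (hα : α ⊆ Γ.star Γ.base) (ha : a ∈ α) (ha' : a.rev ∈ Γ.star Γ.base \ α)
    (hp : p ∈ α) (hpa : p ≠ a) (hq : q ∈ Γ.star Γ.base \ α) (hqa : q ≠ a.rev) :
    ∃ h k l d, h :: k = l ++ [d] ∧ Γ.IsPath Γ.base (h :: k) Γ.base ∧
      FreeGroup.IsCyclicallyReduced (h :: k) ∧ (∀ e ∈ h :: k, e.1 ≠ a.1) ∧
      ind α d ≠ ind α h.rev := by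
  have snoc : ∀ (h : Dart E) k, ∃ l d, h :: k = l ++ [d] := by
    intro h k
    rcases List.eq_nil_or_concat (h :: k) with h | ⟨m, f, h⟩
    · simp at h
    · exact ⟨m, f, by simpa using h⟩
  have hcyc : ∀ (h d : Dart E) k l, h :: k = l ++ [d] → FreeGroup.IsReduced (h :: k) →
      ind α d ≠ ind α h.rev → FreeGroup.IsCyclicallyReduced (h :: k) := by
    intro h d k l hkl hr hne
    rw [isCyclicallyReduced_cons_iff, isReduced_append_iff]
    refine ⟨hr, by simp, ?_⟩
    rw [hkl, List.getLast?_concat]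
    simp only [Option.mem_def, Option.some.injEq, List.head?_cons]
    rintro x rfl y rfl rfl
    exact hne rfl
  have hp1 : p.rev.1 ≠ a.1 := by
    intro h
    rcases Dart.fst_eq_iff.1 h with h | h
    · rw [Dart.rev_eq_iff] at h
      subst h
      exact ha'.2 hp
    · exact hpa (Dart.rev_injective h)
  have hq1 : q.rev.1 ≠ a.1 := by
    intro h
    rcases Dart.fst_eq_iff.1 h with h | h
    · rw [Dart.rev_eq_iff] at h
      exact hqa h
    · rw [Dart.rev_injective h] at hq
      exact hq.2 ha
  have hai : Γ.init a = Γ.base := ha'.1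
  have hat : Γ.term a = Γ.base := hα ha
  have hpt : Γ.init p.rev = Γ.base := by rw [init_rev]; exact hα hp
  have hqt : Γ.init q.rev = Γ.base := by rw [init_rev]; exact hq.1
  obtain ⟨k, hk1, hk2, hk3⟩ := exists_reduced_loop hΓ hai hat hpt hp1
  obtain ⟨l, d, hld⟩ := snoc p.rev k
  have ip : ind α p = 1 := if_pos hp
  have iq : ind α q = 0 := if_neg hq.2
  -- The loop beginning with `p̄` splits `α` if it ends outside `α`; the loop beginning with `q̄`
  -- does if it ends inside. Otherwise their concatenation is reduced, begins with `p̄` and ends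
  -- outside `α`.
  by_cases hd : d ∈ α
  · obtain ⟨k', hk1', hk2', hk3'⟩ := exists_reduced_loop hΓ hai hat hqt hq1
    obtain ⟨l', d', hld'⟩ := snoc q.rev k'
    by_cases hd' : d' ∈ α
    · have hne : ind α d' ≠ ind α q.rev.rev := by
        rw [Dart.rev_rev, iq, show ind α d' = 1 from if_pos hd']
        simp
      exact ⟨q.rev, k', l', d', hld', hk1', hcyc _ _ _ _ hld' hk2' hne, hk3', hne⟩
    · have hne : ind α d' ≠ ind α p.rev.rev := by
        rw [Dart.rev_rev, ip, show ind α d' = 0 from if_neg hd']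
        simp
      have hlast : p.rev :: (k ++ q.rev :: k') = (p.rev :: k ++ l') ++ [d'] := by
        rw [List.append_assoc, ← hld']
        rfl
      have hr : FreeGroup.IsReduced (p.rev :: (k ++ q.rev :: k')) := by
        rw [← List.cons_append, isReduced_append_iff]
        refine ⟨hk2, hk2', ?_⟩
        rw [hld, List.getLast?_concat]
        simp only [Option.mem_def, Option.some.injEq, List.head?_cons]
        rintro x rfl y rfl rfl
        rw [Dart.rev_rev] at hd
        exact hq.2 hd
      refine ⟨p.rev, k ++ q.rev :: k', _, d', hlast, ?_, hcyc _ _ _ _ hlast hr hne, ?_, hne⟩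
      · rw [← List.cons_append, isPath_append]
        exact ⟨_, hk1, hk1'⟩
      · intro e he
        rw [← List.cons_append, List.mem_append] at he
        exact he.elim (hk3 e) (hk3' e)
  · have hne : ind α d ≠ ind α p.rev.rev := by
      rw [Dart.rev_rev, ip, show ind α d = 0 from if_neg hd]
      simp
    exact ⟨p.rev, k, l, d, hld, hk1, hcyc _ _ _ _ hld hk2 hne, hk3, hne⟩

end Loops

end MarkedGraph

/-! ### The action of `G` and the symmetry of invertible ideal edges. -/

namespace MarkedGraph

variable {n : ℕ} {V E : Type*} {Γ : MarkedGraph n V E}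

section MarkedGGraph

open Classical in
theorem isCyclicallyReduced_loopWord (x : MulAut (FreeGroup (Fin n)))
    (c : ConjClasses (FreeGroup (Fin n))) :
    FreeGroup.IsCyclicallyReduced (Γ.loopWord x c) :=
  FreeGroup.reduceCyclically.isCyclicallyReduced FreeGroup.isReduced_toWord

theorem IsMarkedGraph.isPath_pathWord (hΓ : Γ.IsMarkedGraph) (x : MulAut (FreeGroup (Fin n)))
    (g : FreeGroup (Fin n)) : Γ.IsPath Γ.base (Γ.pathWord x g) Γ.base := by
  have : Γ.mark (x g) ∈ Set.range Γ.mark := ⟨_, rfl⟩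
  rw [hΓ.mark_range] at this
  exact this

open Classical in
theorem IsMarkedGraph.isPath_loopWord (hΓ : Γ.IsMarkedGraph) (x : MulAut (FreeGroup (Fin n)))
    (c : ConjClasses (FreeGroup (Fin n))) :
    ∃ a, Γ.IsPath a (Γ.loopWord x c) a :=
  (hΓ.isPath_pathWord x (Quotient.out c)).exists_reduceCyclically

section Abs

variable (G : Subgroup (MulAut (FreeGroup (Fin n)))) [Fintype G] [Fintype E]

theorem outAbs_eq_sum (w : ℕ → ConjClasses (FreeGroup (Fin n))) (A : Set (Dart E)) (i : ℕ) :
    Γ.outAbs G w A i =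
      ∑ x : G, wordAbs (Γ.loopWord x (w i)) (cyclicTurns (Γ.loopWord x (w i))) A :=
  setAbs_eq_sum (fun x : G => Γ.loopWord x (w i)) (fun x : G => cyclicTurns (Γ.loopWord x (w i)))
    (fun _ _ hp => ne_rev_of_mem_cyclicTurns (isCyclicallyReduced_loopWord _ _) hp) A

open Classical in
theorem autAbs_eq_sum (u : ℕ → FreeGroup (Fin n)) (A : Set (Dart E)) (i : ℕ) :
    Γ.autAbs G u A i =
      ∑ x : G, wordAbs (Γ.pathWord x (u i)) (pathTurns (Γ.pathWord x (u i))) A :=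
  setAbs_eq_sum (fun x : G => Γ.pathWord x (u i)) (fun x : G => pathTurns (Γ.pathWord x (u i)))
    (fun _ _ hp => ne_rev_of_mem_pathTurns FreeGroup.isReduced_toWord hp) A

variable {v : V} {α : Set (Dart E)}

theorem outAbs_star_diff (hΓ : Γ.IsMarkedGraph) (w : ℕ → ConjClasses (FreeGroup (Fin n)))
    (hα : α ⊆ Γ.star v) : Γ.outAbs G w (Γ.star v \ α) = Γ.outAbs G w α := by
  funext i
  rw [outAbs_eq_sum, outAbs_eq_sum]
  refine Finset.sum_congr rfl fun x _ => ?_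
  obtain ⟨a, ha⟩ := hΓ.isPath_loopWord x (w i)
  exact ha.wordAbs_star_diff hα

theorem autAbs_star_diff (hΓ : Γ.IsMarkedGraph) (u : ℕ → FreeGroup (Fin n))
    (hα : α ⊆ Γ.star v) (hv : v ≠ Γ.base) : Γ.autAbs G u (Γ.star v \ α) = Γ.autAbs G u α := by
  funext i
  rw [autAbs_eq_sum, autAbs_eq_sum]
  exact Finset.sum_congr rfl fun x _ =>
    (hΓ.isPath_pathWord x (u i)).wordAbs_pathTurns_star_diff hα hv.symm hv.symm

end Abs

variable {G : Subgroup (MulAut (FreeGroup (Fin n)))} [MulAction G V] [MulAction G (Dart E)]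

namespace IsMarkedGGraph

theorem pathWord_mul (hΓ : Γ.IsMarkedGGraph G) (x : G) (y : MulAut (FreeGroup (Fin n)))
    (g : FreeGroup (Fin n)) : Γ.pathWord (x * y) g = (Γ.pathWord y g).map fun d => x • d :=
  hΓ.equivariant x (y g)

theorem loopWord_mul (hΓ : Γ.IsMarkedGGraph G) (x : G) (y : MulAut (FreeGroup (Fin n)))
    (c : ConjClasses (FreeGroup (Fin n))) :
    Γ.loopWord (x * y) c = (Γ.loopWord y c).map fun d => x • d := by
  classical
  have h := hΓ.pathWord_mul x y (Quotient.out c)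
  unfold loopWord
  unfold pathWord at h
  rw [h, reduceCyclically_map _ (MulAction.injective x) (hΓ.smul_rev x)]

theorem smul_star (hΓ : Γ.IsMarkedGGraph G) (x : G) (v : V) :
    x • Γ.star v = Γ.star (x • v) := by
  ext d
  rw [Set.mem_smul_set_iff_inv_smul_mem, mem_star, mem_star, hΓ.smul_term, inv_smul_eq_iff]

/-- Summing over all of `G` makes the absolute value invariant: translating the edge reindexes the
sum. -/
theorem outEdge_smul [Fintype G] (hΓ : Γ.IsMarkedGGraph G)
    (w : ℕ → ConjClasses (FreeGroup (Fin n))) (x : G) (d : Dart E) :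
    Γ.outEdge G w (x • d) = Γ.outEdge G w d := by
  funext i
  unfold outEdge
  refine (Fintype.sum_equiv (Equiv.mulLeft x) _ _ fun y => ?_).symm
  rw [Equiv.coe_mulLeft, Subgroup.coe_mul, hΓ.loopWord_mul,
    edgeCount_map _ (MulAction.injective x) (hΓ.smul_rev x)]

theorem autEdge_smul [Fintype G] (hΓ : Γ.IsMarkedGGraph G)
    (u : ℕ → FreeGroup (Fin n)) (x : G) (d : Dart E) :
    Γ.autEdge G u (x • d) = Γ.autEdge G u d := by
  funext i
  unfold autEdge
  refine (Fintype.sum_equiv (Equiv.mulLeft x) _ _ fun y => ?_).symm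
  rw [Equiv.coe_mulLeft, Subgroup.coe_mul, hΓ.pathWord_mul,
    edgeCount_map _ (MulAction.injective x) (hΓ.smul_rev x)]

variable {v : V} {α : Set (Dart E)}

theorem smul_eq_of_smul_set_eq (hΓ : Γ.IsMarkedGGraph G) (hα : α ⊆ Γ.star v) (hne : α.Nonempty)
    {x : G} (hx : x • α = α) : x • v = v := by
  obtain ⟨d, hd⟩ := hne
  have h1 : x • d ∈ α := hx ▸ Set.smul_mem_smul_set hd
  have h2 : Γ.term (x • d) = v := hα h1
  rwa [hΓ.smul_term, show Γ.term d = v from hα hd] at h2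

theorem smul_star_diff (hΓ : Γ.IsMarkedGGraph G) {x : G} (hx : x • v = v) :
    x • (Γ.star v \ α) = Γ.star v \ (x • α) := by
  rw [Set.smul_set_sdiff, hΓ.smul_star, hx]

/-- The stabilizer of the vertex of an invertible ideal edge stabilizes the ideal edge. -/
theorem smul_set_eq_of_smul_eq (hΓ : Γ.IsMarkedGGraph G) (hα : Γ.IsIdealEdge G v α)
    (hinv : Γ.IsInvertible G v α) {x : G} (hx : x • v = v) : x • α = α := by
  rcases hα.translates x with h | h
  · exact h
  exfalso
  have hxα : x • α ⊆ Γ.star v := by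
    have := Set.smul_set_mono (a := x) hα.subset
    rwa [hΓ.smul_star, hx] at this
  -- Apply the translate condition to `α⁻¹`. Equality would make `x • α` disjoint from itself, so `x
  -- • α⁻¹` and `α⁻¹` are disjoint, which is this inclusion. It contradicts the first clause of
  -- invertibility.
  have hsub : Γ.star v \ α ⊆ x • α := by
    rcases hinv.2.translates x with h' | h'
    · rw [hΓ.smul_star_diff hx] at h'
      intro d hd
      exact absurd hd.2 (by
        have h1 : x • α ⊆ Γ.star v \ (x • α) := by
          rw [h']
          exact fun e he => ⟨hxα he, Set.disjoint_left.1 h he⟩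
        obtain ⟨e, he, -⟩ := hα.nonempty_D
        exact absurd (Set.smul_mem_smul_set he) (h1 (Set.smul_mem_smul_set he)).2)
    · rw [hΓ.smul_star_diff hx] at h'
      intro d hd
      by_contra hd'
      exact Set.disjoint_left.1 h' ⟨hd.1, hd'⟩ hd
  exact hinv.1 (hsub.trans (Set.subset_iUnion (fun x : G => x • α) x))

theorem stabilizer_eq (hΓ : Γ.IsMarkedGGraph G) (hα : Γ.IsIdealEdge G v α)
    (hinv : Γ.IsInvertible G v α) : MulAction.stabilizer G α = MulAction.stabilizer G v := by
  ext x
  rw [MulAction.mem_stabilizer_iff, MulAction.mem_stabilizer_iff]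
  obtain ⟨a, ha, -⟩ := hα.nonempty_D
  exact ⟨hΓ.smul_eq_of_smul_set_eq hα.subset ⟨a, ha⟩, hΓ.smul_set_eq_of_smul_eq hα hinv⟩

theorem stabilizer_star_diff (hΓ : Γ.IsMarkedGGraph G) (hα : Γ.IsIdealEdge G v α)
    (hinv : Γ.IsInvertible G v α) :
    MulAction.stabilizer G (Γ.star v \ α) = MulAction.stabilizer G v := by
  ext x
  rw [MulAction.mem_stabilizer_iff, MulAction.mem_stabilizer_iff]
  obtain ⟨a, ha, -⟩ := hinv.2.nonempty_D
  refine ⟨hΓ.smul_eq_of_smul_set_eq hinv.2.subset ⟨a, ha⟩, fun hx => ?_⟩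
  rw [hΓ.smul_star_diff hx, hΓ.smul_set_eq_of_smul_eq hα hinv hx]

/-- If the stabilizer of `a` is that of its terminal vertex `v` and the orbit of `v` does not
contain the initial vertex of `a`, then the orbit of `a` is a forest. -/
theorem isForest_orbit (hΓ : Γ.IsMarkedGGraph G) {a : Dart E} (hav : Γ.term a = v)
    (hstab : MulAction.stabilizer G v ≤ MulAction.stabilizer G a)
    (hinit : ∀ y : G, y • Γ.init a ≠ v) :
    Γ.IsForest {e | ∃ x : G, e = (x • a).1} := by
  have hterm : ∀ x : G, Γ.term (x • a) = x • v := fun x => by rw [hΓ.smul_term, hav]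
  have hinitx : ∀ x : G, Γ.init (x • a) = x • Γ.init a := fun x => by
    rw [init, hΓ.smul_rev, hΓ.smul_term]; rfl
  have hne : ∀ x y : G, x • Γ.init a ≠ y • v := by
    intro x y h
    refine hinit (y⁻¹ * x) ?_
    rw [mul_smul, h, inv_smul_smul]
  -- Each `x • v` is thus a leaf: exactly one edge of the orbit of `a` ends there.
  have hinj : ∀ x y : G, x • v = y • v → x • a = y • a := by
    intro x y h
    have : y⁻¹ * x ∈ MulAction.stabilizer G v := by
      rw [MulAction.mem_stabilizer_iff, mul_smul, h, inv_smul_smul]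
    have := MulAction.mem_stabilizer_iff.1 (hstab this)
    rw [mul_smul, inv_smul_eq_iff] at this
    exact this
  have hcase : ∀ d : Dart E, d.1 ∈ {e | ∃ x : G, e = (x • a).1} →
      ∃ x : G, d = x • a ∨ d = (x • a).rev := by
    rintro d ⟨x, hx⟩
    exact ⟨x, Dart.fst_eq_iff.1 hx⟩
  have hnext : ∀ (x : G) (d : Dart E), d.1 ∈ {e | ∃ x : G, e = (x • a).1} →
      Γ.init d = x • v → d = (x • a).rev := by
    intro x d hd hdx
    obtain ⟨y, rfl | rfl⟩ := hcase d hd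
    · rw [hinitx] at hdx
      exact absurd hdx (hne _ _)
    · rw [init_rev, hterm] at hdx
      rw [hinj _ _ hdx]
  -- A reduced path in the orbit that has entered a leaf must stop.
  have hafter : ∀ (x : G) (p : List (Dart E)) (b : V), FreeGroup.IsReduced (x • a :: p) →
      Γ.IsPath (x • v) p b → (∀ d ∈ p, d.1 ∈ {e | ∃ x : G, e = (x • a).1}) → p = [] := by
    intro x p b hr hp hF
    cases p with
    | nil => rfl
    | cons d p =>
      have h1 := hnext x d (hF d (by simp)) hp.1
      rw [isReduced_cons_iff] at hr
      exact absurd (by rw [h1, Dart.rev_rev]) (hr.2 d (by simp))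
  intro b p hr hp hF
  cases p with
  | nil => rfl
  | cons d p =>
    exfalso
    have hF' : ∀ d ∈ p, d.1 ∈ {e | ∃ x : G, e = (x • a).1} :=
      fun d hd => hF d (List.mem_cons_of_mem _ hd)
    obtain ⟨hb, hp⟩ := hp
    obtain ⟨x, rfl | rfl⟩ := hcase d (hF d (by simp))
    · rw [hterm] at hp
      obtain rfl := hafter x p b hr hp hF'
      have : x • v = b := hp
      rw [hinitx, ← this] at hb
      exact hne _ _ hb
    · rw [init_rev, hterm] at hb
      rw [term_rev, hinitx] at hp
      cases p with
      | nil =>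
        have : x • Γ.init a = b := hp
        rw [← hb] at this
        exact hne _ _ this
      -- A path leaving one leaf can only run to a second leaf and stop there. If it is closed, the
      -- two leaves agree and the path backtracks.
      | cons e p =>
        obtain ⟨he, hp⟩ := hp
        obtain ⟨y, rfl | rfl⟩ := hcase e (hF' e (by simp))
        · rw [hterm] at hp
          rw [isReduced_cons_iff] at hr
          obtain rfl := hafter y p b hr.1 hp fun d hd => hF' d (List.mem_cons_of_mem _ hd)
          have : y • v = b := hp
          rw [← hb] at this
          exact hr.2 (y • a) (by simp) (by rw [hinj _ _ this])
        · rw [init_rev, hterm] at he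
          exact hne _ _ he.symm

/-- In a reduced `G`-graph, the initial vertex of an edge of `D(α)`, for `α` invertible, lies in the
orbit of the vertex of `α`. -/
theorem exists_smul_init_eq (hΓ : Γ.IsMarkedGGraph G) (hred : Γ.IsReducedGGraph G)
    (hα : Γ.IsIdealEdge G v α) (hinv : Γ.IsInvertible G v α) {a : Dart E} (ha : a ∈ D G α) :
    ∃ y : G, y • Γ.init a = v := by
  by_contra! h
  have hav : Γ.term a = v := hα.subset ha.1
  have hF := hΓ.isForest_orbit hav (by rw [ha.2.1, hΓ.stabilizer_eq hα hinv]) h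
  have := hred _ ?_ hF
  · have h1 : a.1 ∈ {e | ∃ x : G, e = (x • a).1} := ⟨1, by rw [one_smul]⟩
    rw [this] at h1
    exact h1
  · rintro x d ⟨y, hy⟩
    refine ⟨x * y, ?_⟩
    rw [mul_smul]
    rcases Dart.fst_eq_iff.1 hy with rfl | rfl
    · rfl
    · rw [← hΓ.smul_rev]
      rfl

/-- If `y • ā` ends at the vertex of the invertible ideal edge `α`, where `a ∈ D(α)`, then it lies
in `D(α⁻¹)`. -/
theorem smul_rev_mem_D [Finite G] (hΓ : Γ.IsMarkedGGraph G)
    (hα : Γ.IsIdealEdge G v α) (hinv : Γ.IsInvertible G v α) {a : Dart E} (ha : a ∈ D G α)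
    {y : G} (hy : y • Γ.init a = v) : y • a.rev ∈ D G (Γ.star v \ α) := by
  have hav : Γ.term a = v := hα.subset ha.1
  have hstab : MulAction.stabilizer G a = MulAction.stabilizer G v := by
    rw [ha.2.1, hΓ.stabilizer_eq hα hinv]
  have hb : Γ.term (y • a.rev) = v := by rw [hΓ.smul_term, term_rev, hy]
  refine ⟨⟨hb, fun h => ?_⟩, ?_, fun h => ?_⟩
  · refine ha.2.2 (Set.mem_iUnion.2 ⟨y⁻¹, ?_⟩)
    rwa [Set.mem_smul_set_iff_inv_smul_mem, inv_inv]
  · rw [hΓ.stabilizer_star_diff hα hinv]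
    have h1 : MulAction.stabilizer G (y • a.rev) =
        (MulAction.stabilizer G a.rev).map (MulAut.conj y).toMonoidHom :=
      MulAction.stabilizer_smul_eq_stabilizer_map_conj y a.rev
    have h2 : MulAction.stabilizer G a.rev = MulAction.stabilizer G a := by
      ext x
      rw [MulAction.mem_stabilizer_iff, MulAction.mem_stabilizer_iff, ← hΓ.smul_rev,
        Dart.rev_injective.eq_iff]
    -- The stabilizer of `y • ā` is conjugate to that of `v` and contained in it, as `y • ā` ends at
    -- `v`. Finiteness gives equality.
    refine Subgroup.eq_of_le_of_card_ge ?_ ?_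
    · intro x hx
      rw [MulAction.mem_stabilizer_iff] at hx ⊢
      rw [← hb, ← hΓ.smul_term, hx]
    · rw [h1, h2, hstab, Subgroup.card_map_of_injective]
      exact (MulAut.conj y).injective
  -- If `y • a ∈ z • α⁻¹`, then `z⁻¹ * y` fixes `v`, hence `a`, which would put `a` in `α⁻¹`.
  · obtain ⟨z, hz⟩ := Set.mem_iUnion.1 h
    rw [Set.mem_smul_set_iff_inv_smul_mem, hΓ.smul_rev, Dart.rev_rev, ← mul_smul] at hz
    have h3 : (z⁻¹ * y) • v = v := by
      have := hz.1
      rwa [mem_star, hΓ.smul_term, hav] at this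
    have h4 : (z⁻¹ * y) • a = a := by
      rw [← MulAction.mem_stabilizer_iff, hstab]
      exact h3
    rw [h4] at hz
    exact hz.2 ha.1

end IsMarkedGGraph

end MarkedGGraph

end MarkedGraph

/-! ### Translates of words, and the contribution of a split turn. -/

section Words

variable {E : Type*}

theorem isCyclicallyReduced_map (f : Dart E → Dart E) (hf : Function.Injective f)
    (hrev : ∀ d, (f d).rev = f d.rev) {d : Dart E} {l : List (Dart E)}
    (h : FreeGroup.IsCyclicallyReduced (d :: l)) :
    FreeGroup.IsCyclicallyReduced (f d :: l.map f) := by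
  rw [isCyclicallyReduced_cons_iff] at h ⊢
  rw [show f d :: l.map f ++ [f d] = (d :: l ++ [d]).map f by simp]
  unfold FreeGroup.IsReduced at h ⊢
  rw [List.isChain_map]
  refine h.imp fun a b hab => ?_
  rw [Dart.not_cancel_iff] at hab ⊢
  rw [hrev]
  exact fun h' => hab (hf h')

theorem mem_cyclicTurns {h d : Dart E} {k l : List (Dart E)} (hlk : h :: k = l ++ [d]) :
    (d, h) ∈ cyclicTurns (h :: k) := by
  have hlen : l.length = k.length := by simpa using (congrArg List.length hlk).symm
  have : cyclicTurns (h :: k) = (l ++ [d]).zip (k ++ [h]) := by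
    rw [← hlk]; simp [cyclicTurns]
  rw [this, List.zip_append hlen]
  simp

/-- As a sum of squares, the contribution of a word is positive once a single turn separates `A`
from its complement. -/
theorem wordAbs_pos {l : List (Dart E)} {A : Set (Dart E)} {p : Dart E × Dart E}
    (hp : p ∈ cyclicTurns l) (h : ind A p.1 ≠ ind A p.2.rev) :
    0 < wordAbs l (cyclicTurns l) A := by
  rw [wordAbs_cyclicTurns]
  have h1 : 0 < (ind A p.1 - ind A p.2.rev) ^ 2 := by
    have := sub_ne_zero.2 h
    positivity
  refine h1.trans_le (List.single_le_sum (fun x hx => ?_) _ (List.mem_map_of_mem hp))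
  obtain ⟨p, -, rfl⟩ := List.mem_map.1 hx
  positivity

end Words

/-! ### Lengthening of a split loop under the Whitehead move. -/

namespace MarkedGraph

variable {n : ℕ} {V E : Type*} {Γ : MarkedGraph n V E}

section Whitehead

open Classical in
/-- For a `G`-invariant pair `α`, `a`, the Whitehead move `(Gα, Ga)` increases the cyclic length of
a cyclically reduced word which avoids `a` and whose closing turn goes between `α` and its
complement. -/
theorem length_lt_whitehead {G : Type*} [Group G] [MulAction G (Dart E)] {α : Set (Dart E)}
    {a : Dart E} (hα : ∀ x : G, x • α = α) (ha : ∀ x : G, x • a = a)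
    {h d : Dart E} {k l : List (Dart E)} (hlk : h :: k = l ++ [d])
    (hl : FreeGroup.IsCyclicallyReduced (h :: k)) (hav : ∀ e ∈ h :: k, e.1 ≠ a.1)
    (hd : ind α d ≠ ind α h.rev) {g : FreeGroup (Fin n)}
    (hg : IsConj (FreeGroup.mk (h :: k)) (Γ.mark g)) :
    (h :: k).length <
      (FreeGroup.reduceCyclically ((Γ.whitehead G α a).mark g).toWord).length := by
  set S : Set (Set (Dart E)) := MulAction.orbit G α with hS
  set F : Set (E ⊕ S) := {e | ∃ x : G, e = Sum.inl (x • a).1} with hF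
  let s₀ : S := ⟨α, MulAction.mem_orbit_self α⟩
  -- Invariance of `α` makes its orbit a single set, so the blow-up has just one new edge.
  have hs : ∀ β : S, β = s₀ := by
    rintro ⟨β, x, rfl⟩
    exact Subtype.ext (hα x)
  have hFl : ∀ e : E, e ≠ a.1 → (Sum.inl e : E ⊕ S) ∉ F := by
    rintro e he ⟨x, hx⟩
    rw [ha] at hx
    exact he (Sum.inl_injective hx)
  have hFr : (Sum.inr s₀ : E ⊕ S) ∉ F := by
    rintro ⟨x, hx⟩
    cases hx
  let ε : {e : E ⊕ S // e ∉ F} := ⟨Sum.inr s₀, hFr⟩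
  -- The default `ε` is taken only at the collapsed edge, which the words considered avoid.
  let ι : E → {e : E ⊕ S // e ∉ F} := fun e => if he : Sum.inl e ∉ F then ⟨Sum.inl e, he⟩ else ε
  have hι : ∀ e, e ≠ a.1 → ((ι e : {e : E ⊕ S // e ∉ F}) : E ⊕ S) = Sum.inl e := by
    intro e he
    simp only [ι, dif_pos (hFl e he)]
  let c : FreeGroup (E ⊕ S) →* FreeGroup {e : E ⊕ S // e ∉ F} :=
    FreeGroup.lift fun e => if h : e ∈ F then 1 else FreeGroup.of ⟨e, h⟩
  let b : FreeGroup E →* FreeGroup (E ⊕ S) := FreeGroup.lift fun e : E =>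
    (newEdge S (e, false))⁻¹ * FreeGroup.of (Sum.inl e) * newEdge S (e, true)
  have hstem : ∀ d : Dart E, c (newEdge S d) = stem ε α d := by
    intro d
    unfold newEdge stem
    by_cases hdα : d ∈ α
    · have hex : ∃ β : S, d ∈ β.1 := ⟨s₀, hdα⟩
      rw [dif_pos hex, if_pos hdα, hs hex.choose]
      simp only [c, FreeGroup.lift_apply_of, dif_neg hFr, ε]
    · have hex : ¬ ∃ β : S, d ∈ β.1 := by
        rintro ⟨β, hβ⟩
        rw [hs β] at hβ
        exact hdα hβ
      rw [dif_neg hex, if_neg hdα, map_one]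
  have hof : ∀ e : E, e ≠ a.1 → c (FreeGroup.of (Sum.inl e)) = FreeGroup.of (ι e) := by
    intro e he
    simp only [c, FreeGroup.lift_apply_of, dif_neg (hFl e he)]
    congr 1
    exact Subtype.ext (hι e he).symm
  have hθ : ∀ e : E, e ≠ a.1 → c (b (FreeGroup.of e)) =
      (stem ε α (e, false))⁻¹ * FreeGroup.of (ι e) * stem ε α (e, true) := by
    intro e he
    simp only [b, FreeGroup.lift_apply_of, map_mul, map_inv, hstem, hof e he]
  refine length_lt_of_isConj ι ε α (c.comp b) h d l k hlk hl ?_ ?_ ?_ hd hg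
  · rintro ⟨e, j⟩ he
    have h1 := hθ e (hav _ he)
    cases j with
    | true => exact h1
    | false =>
      have h2 : (FreeGroup.mk [(e, false)] : FreeGroup E) = (FreeGroup.of e)⁻¹ := by
        simp [FreeGroup.of, FreeGroup.invRev]
      have h3 : (FreeGroup.mk [(ι e, false)] : FreeGroup {e : E ⊕ S // e ∉ F}) =
          (FreeGroup.of (ι e))⁻¹ := by
        simp [FreeGroup.of, FreeGroup.invRev]
      rw [h2, h3, MonoidHom.comp_apply, map_inv, map_inv, h1]
      simp only [Dart.rev, Bool.not_false]
      group
  · intro d hd e he hde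
    have := congrArg Subtype.val hde
    rw [hι _ (hav d hd), hι _ (hav e he)] at this
    exact Sum.inl_injective this
  · intro d hd hde
    have := congrArg Subtype.val hde
    rw [hι _ (hav d hd)] at this
    cases this

end Whitehead

/-! ### The split conjugacy class and the comparison of reductivities. -/

variable {G : Subgroup (MulAut (FreeGroup (Fin n)))} [MulAction G V] [MulAction G (Dart E)]
  {v : V} {α : Set (Dart E)} {a : Dart E}

namespace IsMarkedGGraph

/-- For an invertible ideal edge `α` at the basepoint and `a ∈ D(α)`, there is a conjugacy class
all of whose translates are represented by cyclically reduced words avoiding `a` whose closing turn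
goes between `α` and its complement. -/
theorem exists_split_conjClass [Finite V] [Finite E] (hΓ : Γ.IsMarkedGGraph G)
    (hred : Γ.IsReducedGGraph G) (hα : Γ.IsIdealEdge G Γ.base α)
    (hinv : Γ.IsInvertible G Γ.base α) (ha : a ∈ D G α) :
    ∃ c : ConjClasses (FreeGroup (Fin n)), ∀ x : G, ∃ (h d : Dart E) (k l : List (Dart E)),
      h :: k = l ++ [d] ∧ FreeGroup.IsCyclicallyReduced (h :: k) ∧ (∀ e ∈ h :: k, e.1 ≠ a.1) ∧
      ind α d ≠ ind α h.rev ∧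
      IsConj (FreeGroup.mk (h :: k))
        (Γ.mark ((x : MulAut (FreeGroup (Fin n))) (Quotient.out c))) := by
  classical
  have hfix : ∀ x : G, x • α = α := fun x => hΓ.smul_set_eq_of_smul_eq hα hinv (hΓ.smul_base x)
  have hfixa : ∀ x : G, x • a = a := fun x => by
    rw [← MulAction.mem_stabilizer_iff, ha.2.1]
    exact hfix x
  obtain ⟨y, hy⟩ := hΓ.exists_smul_init_eq hred hα hinv ha
  -- The initial vertex of `a` lies in the orbit of `*`, which is `{*}`; so `a` is a loop.
  have ha' : a.rev ∈ Γ.star Γ.base \ α := by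
    refine ⟨?_, fun h => ha.2.2 (Set.mem_iUnion.2 ⟨1, by rwa [one_smul]⟩)⟩
    rw [mem_star, term_rev, eq_inv_smul_iff.2 hy, hΓ.smul_base]
  have hfin : α.Finite := α.toFinite
  obtain ⟨p, hp, hpa⟩ : ∃ p ∈ α, p ≠ a := Set.exists_ne_of_one_lt_ncard hα.two_le a
  obtain ⟨q, hq, hqa⟩ : ∃ q ∈ Γ.star Γ.base \ α, q ≠ a.rev :=
    Set.exists_ne_of_one_lt_ncard hinv.2.two_le a.rev
  obtain ⟨h, k, l, d, hlk, hpath, hcyc, hav, hsplit⟩ :=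
    exists_split_loop hΓ.toIsMarkedGraph hα.subset ha.1 ha' hp hpa hq hqa
  have hword : (FreeGroup.mk (h :: k)).toWord = h :: k := by
    rw [FreeGroup.toWord_mk, hcyc.isReduced.reduce_eq]
  obtain ⟨g, hg⟩ : FreeGroup.mk (h :: k) ∈ Set.range Γ.mark := by
    rw [hΓ.mark_range]
    show Γ.IsPath _ _ _
    convert hpath
  -- Each coordinate sums over `G`, so every translate of the loop must be controlled. Since `G`
  -- fixes `α` and `a`, translation preserves both avoidance of `a` and the split turn.
  refine ⟨ConjClasses.mk g, fun x => ⟨x • h, x • d, k.map (fun e => x • e), l.map (fun e => x • e),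
    ?_, ?_, ?_, ?_, ?_⟩⟩
  · simpa using congrArg (List.map fun e => x • e) hlk
  · exact isCyclicallyReduced_map _ (MulAction.injective x) (hΓ.smul_rev x) hcyc
  · intro e he
    have : e ∈ (h :: k).map fun e => x • e := by simpa using he
    obtain ⟨f, hf, rfl⟩ := List.mem_map.1 this
    intro hfa
    refine hav f hf ?_
    rw [Dart.fst_eq_iff] at hfa ⊢
    nth_rewrite 1 2 [← hfixa x] at hfa
    rwa [hΓ.smul_rev, smul_left_cancel_iff, smul_left_cancel_iff] at hfa
  · have hind : ∀ e : Dart E, ind α (x • e) = ind α e := fun e => by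
      refine ind_congr ?_
      nth_rewrite 1 [← hfix x]
      exact Set.smul_mem_smul_set_iff
    rwa [hΓ.smul_rev, hind, hind]
  · have h1 : IsConj g (Quotient.out (ConjClasses.mk g)) :=
      ConjClasses.mk_eq_mk_iff_isConj.1 (Quotient.out_eq (ConjClasses.mk g)).symm
    have h2 : Γ.mark ((x : MulAut (FreeGroup (Fin n))) g) =
        FreeGroup.mk (x • h :: k.map fun e => x • e) := by
      rw [← FreeGroup.mk_toWord (x := Γ.mark ((x : MulAut (FreeGroup (Fin n))) g))]
      congr 1
      have := hΓ.equivariant x g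
      rw [hg] at this
      convert this
      rw [← List.map_cons (f := fun e => x • e)]
      congr 1
      convert hword.symm
    rw [← h2]
    exact Γ.mark.map_isConj
      ((x : MulAut (FreeGroup (Fin n))).toMonoidHom.map_isConj h1)

variable [Fintype G] [Fintype E]

/-- At the split class every translate contributes nothing to `|a|_out` and a positive amount to
`|α|_out`, so that coordinate is negative. -/
theorem redOut_ne_zero [Finite V] {w : ℕ → ConjClasses (FreeGroup (Fin n))}
    (hw : Function.Surjective w) (hΓ : Γ.IsMarkedGGraph G)
    (hred : Γ.IsReducedGGraph G) (hα : Γ.IsIdealEdge G Γ.base α)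
    (hinv : Γ.IsInvertible G Γ.base α) (ha : a ∈ D G α) : Γ.redOut G w α a ≠ 0 := by
  classical
  obtain ⟨c, hc⟩ := hΓ.exists_split_conjClass hred hα hinv ha
  obtain ⟨i, rfl⟩ := hw c
  have key : ∀ x : G, edgeCount (Γ.loopWord x (w i)) a = 0 ∧
      0 < wordAbs (Γ.loopWord x (w i)) (cyclicTurns (Γ.loopWord x (w i))) α := by
    intro x
    obtain ⟨h, d, k, l, hlk, hcyc, hav, hsplit, hconj⟩ := hc x
    have hrot : (Γ.loopWord x (w i)).IsRotated (h :: k) :=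
      isRotated_reduceCyclically_toWord_of_isConj hcyc hconj
    exact ⟨edgeCount_eq_zero fun e he => hav e (hrot.mem_iff.1 he),
      wordAbs_pos (p := (d, h)) ((isRotated_cyclicTurns hrot).mem_iff.2 (mem_cyclicTurns hlk))
        hsplit⟩
  intro h0
  have h1 := congrFun h0 i
  have h2 : Γ.outEdge G w a i = 0 := Finset.sum_eq_zero fun x _ => (key x).1
  have h3 : 0 < Γ.outAbs G w α i := by
    rw [outAbs_eq_sum]
    exact Finset.sum_pos (fun x _ => (key x).2) Finset.univ_nonempty
  have h4 : ((MulAction.stabilizer G α).index : ℤ) ≠ 0 :=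
    Nat.cast_ne_zero.2 Subgroup.index_ne_zero_of_finite
  simp only [redOut, Pi.smul_apply, Pi.sub_apply, h2, Pi.zero_apply, smul_eq_mul, mul_eq_zero,
    h4, false_or] at h1
  omega

/-- At the split class every summand of the norm strictly increases. The sign of `red_tot(α, a)`
plays no role. -/
theorem outNorm_whitehead_ne [Finite V] {w : ℕ → ConjClasses (FreeGroup (Fin n))}
    (hw : Function.Surjective w) (hΓ : Γ.IsMarkedGGraph G)
    (hred : Γ.IsReducedGGraph G) (hα : Γ.IsIdealEdge G Γ.base α)
    (hinv : Γ.IsInvertible G Γ.base α) (ha : a ∈ D G α) :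
    (Γ.whitehead G α a).outNorm G w ≠ Γ.outNorm G w := by
  classical
  obtain ⟨c, hc⟩ := hΓ.exists_split_conjClass hred hα hinv ha
  obtain ⟨i, rfl⟩ := hw c
  have hfix : ∀ x : G, x • α = α := fun x => hΓ.smul_set_eq_of_smul_eq hα hinv (hΓ.smul_base x)
  have hfixa : ∀ x : G, x • a = a := fun x => by
    rw [← MulAction.mem_stabilizer_iff, ha.2.1]
    exact hfix x
  intro h0
  refine (Finset.sum_lt_sum_of_nonempty Finset.univ_nonempty fun x _ => ?_).ne'
    (congrFun h0 i)
  obtain ⟨h, d, k, l, hlk, hcyc, hav, hsplit, hconj⟩ := hc x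
  have hrot : (Γ.loopWord x (w i)).IsRotated (h :: k) :=
    isRotated_reduceCyclically_toWord_of_isConj hcyc hconj
  rw [hrot.perm.length_eq, Nat.cast_lt]
  have := length_lt_whitehead hfix hfixa hlk hcyc hav hsplit hconj
  unfold loopWord
  convert this

/-- All three ingredients agree: the index, because both stabilizers are that of `v`; the absolute
value of the set, by complementation; that of the edge, by invariance under `G` and reversal. -/
theorem redOut_star_diff (w : ℕ → ConjClasses (FreeGroup (Fin n))) (hΓ : Γ.IsMarkedGGraph G)
    (hα : Γ.IsIdealEdge G v α) (hinv : Γ.IsInvertible G v α) (y : G) :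
    Γ.redOut G w (Γ.star v \ α) (y • a.rev) = Γ.redOut G w α a := by
  unfold redOut
  rw [hΓ.stabilizer_star_diff hα hinv, hΓ.stabilizer_eq hα hinv,
    outAbs_star_diff G hΓ.toIsMarkedGraph w hα.subset, hΓ.outEdge_smul]
  congr 2
  funext i
  exact Finset.sum_congr rfl fun x _ => edgeCount_rev _ _

theorem redAut_star_diff (u : ℕ → FreeGroup (Fin n)) (hΓ : Γ.IsMarkedGGraph G)
    (hα : Γ.IsIdealEdge G v α) (hinv : Γ.IsInvertible G v α) (hv : v ≠ Γ.base) (y : G) :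
    Γ.redAut G u (Γ.star v \ α) (y • a.rev) = Γ.redAut G u α a := by
  unfold redAut
  rw [hΓ.stabilizer_star_diff hα hinv, hΓ.stabilizer_eq hα hinv,
    autAbs_star_diff G hΓ.toIsMarkedGraph u hα.subset hv, hΓ.autEdge_smul]
  congr 2
  funext i
  exact Finset.sum_congr rfl fun x _ => edgeCount_rev _ _

end IsMarkedGGraph

end MarkedGraph

/-! ### Positivity in the lexicographic order. -/

namespace MarkedGraph

variable {n : ℕ} {V E : Type*} {Γ : MarkedGraph n V E}
  {G : Subgroup (MulAut (FreeGroup (Fin n)))} [Fintype G] [Fintype E] [MulAction G (Dart E)]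
  {α : Set (Dart E)} {a : Dart E}

theorem redTot_pos_iff {w : ℕ → ConjClasses (FreeGroup (Fin n))} {u : ℕ → FreeGroup (Fin n)} :
    0 < Γ.redTot G w u α a ↔ 0 < toLex (Γ.redOut G w α a) ∨
      0 = toLex (Γ.redOut G w α a) ∧ 0 < toLex (Γ.redAut G u α a) :=
  Prod.Lex.lt_iff

/-- `D(α)` is finite, so the maximum is attained as soon as one positive value exists. -/
theorem isTotReductive_iff {w : ℕ → ConjClasses (FreeGroup (Fin n))}
    {u : ℕ → FreeGroup (Fin n)} :
    Γ.IsTotReductive G w u α ↔ ∃ a ∈ D G α, 0 < Γ.redTot G w u α a := by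
  constructor
  · rintro ⟨r, ⟨⟨a, ha, rfl⟩, -⟩, hr⟩
    exact ⟨a, ha, hr⟩
  · rintro ⟨a, ha, hr⟩
    obtain ⟨b, hb, hmax⟩ :=
      Set.exists_max_image (D G α) (fun a => Γ.redTot G w u α a) (Set.toFinite _) ⟨a, ha⟩
    exact ⟨_, ⟨⟨b, hb, rfl⟩, by rintro _ ⟨c, hc, rfl⟩; exact hmax c hc⟩, hr.trans_le (hmax a ha)⟩

end MarkedGraph

end AuterSpace

end

/-! ### The proposition. -/

open AuterSpace
theorem mainTheorem3 (n : ℕ) (G : Subgroup (MulAut (FreeGroup (Fin n)))) [Fintype G]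
    {V E : Type*} [Finite V] [Fintype E] [MulAction G V] [MulAction G (Dart E)]
    (w : ℕ → ConjClasses (FreeGroup (Fin n))) (hw : Function.Surjective w)
    (u : ℕ → FreeGroup (Fin n)) (hu : Function.Surjective u)
    (ρ : MarkedGraph n V E) (hρ : ρ.IsMarkedGGraph G) (hred : ρ.IsReducedGGraph G)
    (v : V) (α : Set (Dart E)) (hα : ρ.IsIdealEdge G v α)
    (hinv : ρ.IsInvertible G v α) (htot : ρ.IsTotReductive G w u α) :
    ρ.IsTotReductive G w u (ρ.star v \ α) ∧
      (v = ρ.base → ∀ a ∈ MarkedGraph.D G α, 0 < ρ.redTot G w u α a →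
        (ρ.whitehead G α a).outNorm G w ≠ ρ.outNorm G w) := by
  constructor
  · obtain ⟨a, ha, hpos⟩ := MarkedGraph.isTotReductive_iff.1 htot
    obtain ⟨y, hy⟩ := hρ.exists_smul_init_eq hred hα hinv ha
    refine MarkedGraph.isTotReductive_iff.2 ⟨_, hρ.smul_rev_mem_D hα hinv ha hy, ?_⟩
    rw [MarkedGraph.redTot_pos_iff] at hpos ⊢
    rw [hρ.redOut_star_diff w hα hinv]
    -- At the basepoint a tie in the out coordinate is impossible, so the aut coordinate is never
    -- consulted. Elsewhere the two coordinates both carry over to `α⁻¹`.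
    by_cases hv : v = ρ.base
    · subst hv
      refine hpos.imp_right fun h => ?_
      exact absurd (toLex.injective h.1.symm) (hρ.redOut_ne_zero hw hred hα hinv ha)
    · rwa [hρ.redAut_star_diff u hα hinv hv]
  · rintro rfl a ha -
    exact hρ.outNorm_whitehead_ne hw hred hα hinv ha
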